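/- For real $x$ let $$\mathrm{Ai}(x)=\frac{1}{2\pi i}\int_{\infty e^{-i\pi/3}}^{\infty e^{i\pi/3}}\exp(\zeta^3/3-\zeta x)\,d\zeta$$ be the Airy function, where the contour consists of the two rays from the origin at angles $\pm\pi/3$. Fix $a\in\mathbb R$ and $\lambda>0$. Let $\psi_k$, $k=0,1,2,\ldots$, be the eigenfunctions of the eigenvalue problem $$-\psi''+\Big(ax^2+\frac{\lambda}{2}x^4\Big)\psi=E\psi\quad(x\in\mathbb R),\qquad \lim_{x\to\pm\infty}\psi(x)=0,$$ normalised by the asymptotic behaviour $$\psi_k(x)\sim x^{-1}\exp\Big(-\frac{(\lambda/2)^{1/2}}{3}x^3-\frac{a}{2(\lambda/2)^{1/2}}x\Big),\qquad x\to+\infty .$$ Put $$\mathcal K(x,y,z)=\lambda^{1/3}\exp\big((\lambda/2)^{1/2}xyz\big)\,\mathrm{Ai}\Big(\frac{\lambda^{1/3}}{2}(x^2+y^2+z^2)+\frac{a}{\lambda^{2/3}}\Big).$$ Then every $\psi=\psi_k$ (that is, every eigenfunction of the problem, for any real eigenvalue $E$, with this normalisation) satisfies, for all $x,y\in\mathbb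 R$, the product formula $$\psi(x)\psi(y)=\int_{\mathbb R}\psi(z)\,\mathcal K(x,y,z)\,dz,$$ the integral being absolutely convergent. Moreover, $\mathrm{Ai}$ has a largest real zero $a_1$ (its "first zero"), and if $a>\lambda^{2/3}a_1$, then $\mathcal K(x,y,z)>0$ for all $x,y,z\in\mathbb R$. -/

import Mathlib

open MeasureTheory Filter Topology

namespace QuarticOscillator

noncomputable section

/-- The integral of `f` along the ray from `0` to infinity in direction `ω`. -/
def rayIntegral (ω : ℂ) (f : ℂ → ℂ) : ℂ :=
  ∫ t in Set.Ioi (0 : ℝ), f (t * ω) * ω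

/-- `(1 / 2πi) ∫ exp(ζ³/3 - ζ x) dζ` along the contour that comes in from infinity on the ray
at angle `-π/3` to the origin and goes out to infinity on the ray at angle `π/3`. -/
def airyContour (x : ℝ) : ℂ :=
  1 / (2 * Real.pi * Complex.I) *
    (rayIntegral (Complex.exp (Real.pi / 3 * Complex.I))
        (fun ζ => Complex.exp (ζ ^ 3 / 3 - ζ * x))
      - rayIntegral (Complex.exp (-(Real.pi / 3 * Complex.I)))
        (fun ζ => Complex.exp (ζ ^ 3 / 3 - ζ * x)))

/-- The Airy function `Ai` on the real line. The contour integral is real for real `x`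
(`airyAi_eq_airyContour`), so that taking the real part loses nothing. -/
def airyAi (x : ℝ) : ℝ := (airyContour x).re

theorem airyAi_eq_airyContour (x : ℝ) : (airyAi x : ℂ) = airyContour x := by
  have key : (starRingEnd ℂ) (rayIntegral (Complex.exp (Real.pi / 3 * Complex.I))
        (fun ζ => Complex.exp (ζ ^ 3 / 3 - ζ * x))) =
      rayIntegral (Complex.exp (-(Real.pi / 3 * Complex.I)))
        (fun ζ => Complex.exp (ζ ^ 3 / 3 - ζ * x)) := by
    unfold rayIntegral
    rw [← integral_conj]
    congr 1
    funext t
    simp [← Complex.exp_conj, map_ofNat]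
  unfold airyAi
  apply Complex.conj_eq_iff_re.mp
  unfold airyContour
  rw [map_mul, map_sub, key, ← key, Complex.conj_conj]
  simp [map_ofNat]
  ring

/-- The first zero `a₁` of `Ai`: counted from the right, that is the largest real zero. -/
def airyFirstZero : ℝ := sSup {s : ℝ | airyAi s = 0}

/-- `ψ` is an eigenfunction, with eigenvalue `E`, of
`-ψ'' + (a x² + (lam / 2) x⁴) ψ = E ψ` on the real line with `ψ → 0` at `±∞`. -/
structure IsEigenfunction (a lam E : ℝ) (ψ : ℝ → ℝ) : Prop where
  differentiable : Differentiable ℝ ψ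
  differentiable_deriv : Differentiable ℝ (deriv ψ)
  ode : ∀ x : ℝ, -deriv (deriv ψ) x + (a * x ^ 2 + lam / 2 * x ^ 4) * ψ x = E * ψ x
  ne_zero : ψ ≠ 0
  tendsto_atTop : Tendsto ψ atTop (𝓝 0)
  tendsto_atBot : Tendsto ψ atBot (𝓝 0)

/-- The normalisation of the eigenfunctions by their behaviour as `x → +∞`. -/
def IsNormalized (a lam : ℝ) (ψ : ℝ → ℝ) : Prop :=
  Asymptotics.IsEquivalent atTop ψ
    (fun x : ℝ => x⁻¹ * Real.exp (-(√(lam / 2) / 3) * x ^ 3 - a / (2 * √(lam / 2)) * x))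

/-- The kernel function. -/
def kernelK (a lam x y z : ℝ) : ℝ :=
  lam ^ (1 / 3 : ℝ) * Real.exp (√(lam / 2) * x * y * z) *
    airyAi (lam ^ (1 / 3 : ℝ) / 2 * (x ^ 2 + y ^ 2 + z ^ 2) + a / lam ^ (2 / 3 : ℝ))

end

end QuarticOscillator

/-!
The kernel `K` is built so that `K_xx - V(x) K`, with `V` the quartic potential, is a symmetric function
of `x, y, z`; this follows from the Airy equation `Ai''(s) = s Ai(s)`. Hence, for an eigenfunction `ψ`,
differentiation under the integral sign and Green's identity in `z` show that
`F(x) = ∫ ψ(z) K(x, y, z) dz` solves the equation `F'' = (V - E) F` of `ψ`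
(`IsBoundedSolution.hasDerivAt_integral_deriv`). As `x → ∞`, Laplace's method, with the mass of the
kernel concentrating at `z = y`, shows that `F` divided by the normalising profile tends to `ψ(y)`
(`IsBoundedSolution.tendsto_integral_div_profile`). In particular `F` decays, and since `V - E` is
eventually positive, a decaying solution is unique up to a factor (`eq_zero_of_tendsto_zero`). So
`F = k ψ`, and the asymptotics of `F` and `ψ` give `k = ψ(y)`.

What is needed about `Ai` comes from its contour integral. The difference of the two ray integrals does
not depend on the real vertex from which the rays issue (`airyMoment_zero_eq`). The vertex `1` gives
the decay of `Ai` and `Ai'`, and the saddle point `√s` gives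
`Ai(s) ∼ exp (-2 s ^ (3 / 2) / 3) / (2 √π s ^ (1 / 4))` (`airyAi_sq`, `tendsto_airyAmplitude`). Thus `Ai` is
positive far to the right, while it has a zero by Sturm comparison with the sine
(`exists_airyAi_eq_zero`). So there is a largest zero, to the right of which `Ai`, and with it the kernel,
is positive.

The computations use `m = (lam / 8) ^ (1 / 6)` and `α = a / (4 m ^ 6)`, which turn the fractional powers
in the kernel into polynomials.
-/

namespace QuarticOscillator

variable {m α : ℝ}

/-! ### Airy integrals along rays -/

/-- The directions `exp (± π i / 3)` of the Airy contour, as the two roots of `ω ^ 2 = ω - 1`. -/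
structure IsAiryDirection (ω : ℂ) : Prop where
  sq_eq : ω ^ 2 = ω - 1
  re_eq : ω.re = 1 / 2

/-- The pullback of `ζ ^ n * exp (ζ ^ 3 / 3 - ζ * s) dζ` to the ray `ζ = q + t * ω`. -/
noncomputable def airyIntegrand (ω : ℂ) (n : ℕ) (q s t : ℝ) : ℂ :=
  (q + t * ω) ^ n * Complex.exp ((q + t * ω) ^ 3 / 3 - (q + t * ω) * s) * ω

/-- The integral of `ζ ^ n * exp (ζ ^ 3 / 3 - ζ * s)` along the ray from the real point `q` to
infinity in direction `ω`. -/
noncomputable def airyRay (ω : ℂ) (n : ℕ) (q s : ℝ) : ℂ :=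
  ∫ t in Set.Ioi (0 : ℝ), airyIntegrand ω n q s t

/-- An integrable majorant of the integrand of `airyRay`, up to the factor `exp (-(q * s))`,
uniform in `|q| ≤ R` and `s ≥ -S`. -/
noncomputable def airyBound (n : ℕ) (R S t : ℝ) : ℝ :=
  Real.exp (-t ^ 3 / 3 + R / 2 * t ^ 2 + (n + R ^ 2 / 2 + S / 2) * t + (n * R + R ^ 3 / 3))

theorem exists_cubic_le (α β : ℝ) (hα : 0 ≤ α) (hβ : 0 ≤ β) :
    ∃ C : ℝ, ∀ t : ℝ, 0 ≤ t → -t ^ 3 / 3 + α * t ^ 2 + β * t ≤ C := by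
  set T := 3 * (α + β) + 1 with hT
  refine ⟨α * T ^ 2 + β * T, fun t ht => ?_⟩
  rcases le_total t T with h | h
  · have h1 : t ^ 2 ≤ T ^ 2 := by gcongr
    have h2 : 0 ≤ t ^ 3 := by positivity
    nlinarith [mul_le_mul_of_nonneg_left h1 hα, mul_le_mul_of_nonneg_left h hβ]
  · have hT1 : 1 ≤ T := by linarith
    have h2 : t ≤ t ^ 2 := by nlinarith
    have h3 : T * t ^ 2 ≤ t ^ 3 := by nlinarith [sq_nonneg t]
    have h4 : 0 ≤ α * T ^ 2 + β * T := by positivity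
    nlinarith [mul_le_mul_of_nonneg_left h2 hβ, sq_nonneg t]

theorem integrableOn_airyBound (n : ℕ) {R S : ℝ} (hR : 0 ≤ R) (hS : 0 ≤ S) :
    IntegrableOn (airyBound n R S) (Set.Ioi 0) := by
  obtain ⟨C, hC⟩ := exists_cubic_le (R / 2) (n + R ^ 2 / 2 + S / 2 + 1) (by positivity)
    (by positivity)
  refine Integrable.mono' ((exp_neg_integrableOn_Ioi 0 one_pos).const_mul
    (Real.exp (C + (n * R + R ^ 3 / 3)))) ?_ ?_
  · exact Continuous.aestronglyMeasurable (by unfold airyBound; fun_prop)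
  · refine (ae_restrict_mem measurableSet_Ioi).mono fun t ht => ?_
    rw [airyBound, Real.norm_eq_abs, Real.abs_exp, ← Real.exp_add]
    have := hC t (le_of_lt ht)
    exact Real.exp_le_exp.2 (by linarith)

namespace IsAiryDirection

variable {ω : ℂ} (hω : IsAiryDirection ω)
include hω

theorem cube_eq : ω ^ 3 = -1 := by
  linear_combination (ω + 1) * hω.sq_eq

theorem norm_eq : ‖ω‖ = 1 := by
  have h : ‖ω‖ ^ 3 = 1 := by rw [← norm_pow, hω.cube_eq]; simp
  exact (pow_eq_one_iff_of_nonneg (norm_nonneg _) (by norm_num)).1 h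

theorem re_phase (q s t : ℝ) :
    ((q + t * ω : ℂ) ^ 3 / 3 - (q + t * ω) * s).re =
      q ^ 3 / 3 + q ^ 2 * t / 2 - q * t ^ 2 / 2 - t ^ 3 / 3 - (q + t / 2) * s := by
  have h : (q + t * ω : ℂ) ^ 3 / 3 - (q + t * ω) * s =
      ((q ^ 3 / 3 - q * t ^ 2 - t ^ 3 / 3 - q * s : ℝ) : ℂ) +
        ((q ^ 2 * t + q * t ^ 2 - t * s : ℝ) : ℂ) * ω := by
    push_cast
    linear_combination (q * t ^ 2 : ℂ) * hω.sq_eq + (t ^ 3 / 3 : ℂ) * hω.cube_eq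
  rw [h, Complex.add_re, Complex.re_ofReal_mul, Complex.ofReal_re, hω.re_eq]
  ring

theorem norm_airyIntegrand_le (n : ℕ) {R S q s t : ℝ} (hq : |q| ≤ R) (hs : -S ≤ s)
    (ht : 0 ≤ t) :
    ‖airyIntegrand ω n q s t‖ ≤ Real.exp (-(q * s)) * airyBound n R S t := by
  have h1 : ‖(q + t * ω : ℂ)‖ ≤ Real.exp (R + t) := by
    calc ‖(q + t * ω : ℂ)‖ ≤ |q| + t := by
          refine (norm_add_le _ _).trans ?_
          simp [hω.norm_eq, abs_of_nonneg ht]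
      _ ≤ R + t := by linarith
      _ ≤ Real.exp (R + t) := by linarith [Real.add_one_le_exp (R + t)]
  have hR := abs_le.1 hq
  have hR0 : 0 ≤ R := (abs_nonneg q).trans hq
  have h2 : q ^ 2 ≤ R ^ 2 := sq_le_sq' hR.1 hR.2
  have h3 : q ^ 3 ≤ R ^ 3 := pow_le_pow_left₀ hR0 (le_refl R) 3 |>.trans' (by
    have := (Odd.strictMono_pow (R := ℝ) (n := 3) (by decide)).monotone hR.2
    simpa using this)
  calc ‖airyIntegrand ω n q s t‖
      = ‖(q + t * ω : ℂ)‖ ^ n *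
          Real.exp ((q + t * ω : ℂ) ^ 3 / 3 - (q + t * ω) * s).re := by
        rw [airyIntegrand, norm_mul, norm_mul, norm_pow, Complex.norm_exp, hω.norm_eq, mul_one]
    _ ≤ Real.exp (R + t) ^ n *
          Real.exp ((q + t * ω : ℂ) ^ 3 / 3 - (q + t * ω) * s).re := by gcongr
    _ ≤ Real.exp (-(q * s)) * airyBound n R S t := by
        rw [← Real.exp_nat_mul, airyBound, ← Real.exp_add, ← Real.exp_add, hω.re_phase]
        refine Real.exp_le_exp.2 ?_
        nlinarith [mul_le_mul_of_nonneg_right h2 ht,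
          mul_le_mul_of_nonneg_right hR.1 (sq_nonneg t), mul_le_mul_of_nonneg_right hs ht]

omit hω in
theorem continuous_airyIntegrand (n : ℕ) (q s : ℝ) : Continuous (airyIntegrand ω n q s) := by
  unfold airyIntegrand
  fun_prop

theorem integrableOn_airyIntegrand (n : ℕ) (q s : ℝ) :
    IntegrableOn (airyIntegrand ω n q s) (Set.Ioi 0) := by
  refine Integrable.mono' ((integrableOn_airyBound n (abs_nonneg q) (abs_nonneg s)).const_mul
    (Real.exp (-(q * s)))) (continuous_airyIntegrand n q s).aestronglyMeasurable ?_
  exact (ae_restrict_mem measurableSet_Ioi).mono fun t ht =>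
    hω.norm_airyIntegrand_le n le_rfl (neg_abs_le s) (le_of_lt ht)

/-- Integrals along a ray starting at `q` decay like `exp (-q * s)`. -/
theorem exists_norm_airyRay_le (n : ℕ) (q S : ℝ) :
    ∃ C : ℝ, 0 ≤ C ∧ ∀ s : ℝ, -S ≤ s → ‖airyRay ω n q s‖ ≤ C * Real.exp (-(q * s)) := by
  refine ⟨∫ t in Set.Ioi (0 : ℝ), airyBound n |q| |S| t,
    integral_nonneg fun t => (Real.exp_pos _).le, fun s hs => ?_⟩
  rw [mul_comm, ← integral_const_mul]
  refine norm_integral_le_of_norm_le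
    ((integrableOn_airyBound n (abs_nonneg q) (abs_nonneg S)).const_mul _) ?_
  exact (ae_restrict_mem measurableSet_Ioi).mono fun t ht =>
    hω.norm_airyIntegrand_le n le_rfl ((neg_le_neg (le_abs_self S)).trans hs) (le_of_lt ht)

theorem hasDerivAt_airyRay (n : ℕ) (q s : ℝ) :
    HasDerivAt (fun s => airyRay ω n q s) (-airyRay ω (n + 1) q s) s := by
  have key := (hasDerivAt_integral_of_dominated_loc_of_deriv_le
    (μ := volume.restrict (Set.Ioi (0 : ℝ)))
    (F := fun s t => airyIntegrand ω n q s t) (F' := fun s t => -airyIntegrand ω (n + 1) q s t)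
    (x₀ := s) (s := Metric.ball s 1)
    (bound := fun t => Real.exp (|q| * (|s| + 1)) * airyBound (n + 1) |q| (|s| + 1) t)
    (Metric.ball_mem_nhds s one_pos)
    (Eventually.of_forall fun s => (continuous_airyIntegrand n q s).aestronglyMeasurable)
    (hω.integrableOn_airyIntegrand n q s)
    (continuous_airyIntegrand (n + 1) q s).neg.aestronglyMeasurable ?_
    ((integrableOn_airyBound (n + 1) (abs_nonneg q) (by positivity)).const_mul _) ?_).2
  · rwa [integral_neg] at key
  · refine (ae_restrict_mem measurableSet_Ioi).mono fun t ht x hx => ?_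
    have hx' : |x| ≤ |s| + 1 := by
      rw [Metric.mem_ball, Real.dist_eq] at hx
      linarith [abs_sub_abs_le_abs_sub x s]
    rw [norm_neg]
    refine (hω.norm_airyIntegrand_le (n + 1) le_rfl (abs_le.1 hx').1 (le_of_lt ht)).trans ?_
    refine mul_le_mul_of_nonneg_right (Real.exp_le_exp.2 ?_) (Real.exp_pos _).le
    calc -(q * x) ≤ |q * x| := neg_le_abs _
      _ = |q| * |x| := abs_mul _ _
      _ ≤ |q| * (|s| + 1) := by gcongr
  · refine Eventually.of_forall fun t x _ => ?_
    have h1 : HasDerivAt (fun x : ℝ => (q + t * ω : ℂ) ^ 3 / 3 - (q + t * ω) * x)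
        (-(q + t * ω)) x := by
      simpa using ((hasDerivAt_id x).ofReal_comp.const_mul (q + t * ω : ℂ)).const_sub
        ((q + t * ω : ℂ) ^ 3 / 3)
    have h2 := ((h1.cexp.const_mul ((q + t * ω : ℂ) ^ n)).mul_const ω)
    refine h2.congr_deriv ?_
    simp only [airyIntegrand]
    ring

omit hω in
/-- The derivative of `exp (ζ ^ 3 / 3 - ζ * s)` is `(ζ ^ 2 - s) * exp (ζ ^ 3 / 3 - ζ * s)`. -/
theorem hasDerivAt_exp_phase (s : ℝ) {ζ : ℝ → ℂ} {ζ' : ℂ} {t : ℝ} (h : HasDerivAt ζ ζ' t) :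
    HasDerivAt (fun t => Complex.exp (ζ t ^ 3 / 3 - ζ t * s))
      ((ζ t ^ 2 - s) * Complex.exp (ζ t ^ 3 / 3 - ζ t * s) * ζ') t := by
  refine (((h.pow 3).div_const 3).sub (h.mul_const (s : ℂ))).cexp.congr_deriv ?_
  simp
  ring

/-- Integration of the exact form `d exp (ζ ^ 3 / 3 - ζ * s)` along a ray. -/
theorem airyRay_two_sub (q s : ℝ) :
    airyRay ω 2 q s - s * airyRay ω 0 q s = -Complex.exp (q ^ 3 / 3 - q * s) := by
  have hint := (hω.integrableOn_airyIntegrand 2 q s).sub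
    ((hω.integrableOn_airyIntegrand 0 q s).const_mul (s : ℂ))
  have hd : ∀ t : ℝ, HasDerivAt
      (fun t : ℝ => Complex.exp ((q + t * ω : ℂ) ^ 3 / 3 - (q + t * ω) * s))
      (airyIntegrand ω 2 q s t - s * airyIntegrand ω 0 q s t) t := fun t => by
    have h := hasDerivAt_exp_phase s
      (((hasDerivAt_id t).ofReal_comp.mul_const ω).const_add (q : ℂ))
    refine h.congr_deriv ?_
    simp only [airyIntegrand, id]
    push_cast
    ring
  have hlim : Tendsto (fun t : ℝ => Complex.exp ((q + t * ω : ℂ) ^ 3 / 3 - (q + t * ω) * s))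
      atTop (𝓝 0) := by
    have hint0 := hω.integrableOn_airyIntegrand 0 q s
    rw [show (fun t : ℝ => Complex.exp ((q + t * ω : ℂ) ^ 3 / 3 - (q + t * ω) * s)) =
      fun t => airyIntegrand ω 0 q s t * ω⁻¹ from ?_]
    · refine tendsto_zero_of_hasDerivAt_of_integrableOn_Ioi
        (a := 0) (f' := fun t => (airyIntegrand ω 2 q s t - s * airyIntegrand ω 0 q s t)) ?_ hint
        (hint0.mul_const _)
      intro t _
      refine (hd t).congr_of_eventuallyEq (Eventually.of_forall fun t => ?_)
      simp [airyIntegrand, norm_ne_zero_iff.1 (hω.norm_eq.trans_ne one_ne_zero)]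
    · funext t
      simp [airyIntegrand, norm_ne_zero_iff.1 (hω.norm_eq.trans_ne one_ne_zero)]
  have h := integral_Ioi_of_hasDerivAt_of_tendsto' (a := 0) (fun t _ => hd t) hint hlim
  rw [integral_sub (hω.integrableOn_airyIntegrand 2 q s)
    ((hω.integrableOn_airyIntegrand 0 q s).const_mul (s : ℂ)), integral_const_mul] at h
  simpa [airyRay] using h

/-- The rate of change when the vertex moves does not depend on the direction `ω`. -/
theorem hasDerivAt_airyRay_start (q s : ℝ) :
    HasDerivAt (fun q => airyRay ω 0 q s) (-Complex.exp (q ^ 3 / 3 - q * s)) q := by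
  rw [← hω.airyRay_two_sub]
  have hpos : 0 ≤ |q| + 1 := by positivity
  have key := (hasDerivAt_integral_of_dominated_loc_of_deriv_le
    (μ := volume.restrict (Set.Ioi (0 : ℝ)))
    (F := fun q t => airyIntegrand ω 0 q s t)
    (F' := fun q t => airyIntegrand ω 2 q s t - s * airyIntegrand ω 0 q s t)
    (x₀ := q) (s := Metric.ball q 1)
    (bound := fun t => Real.exp ((|q| + 1) * |s|) * airyBound 2 (|q| + 1) |s| t +
      |s| * (Real.exp ((|q| + 1) * |s|) * airyBound 0 (|q| + 1) |s| t))
    (Metric.ball_mem_nhds q one_pos)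
    (Eventually.of_forall fun q => (continuous_airyIntegrand 0 q s).aestronglyMeasurable)
    (hω.integrableOn_airyIntegrand 0 q s)
    ((continuous_airyIntegrand 2 q s).sub
      ((continuous_airyIntegrand 0 q s).const_mul _)).aestronglyMeasurable ?_
    (((integrableOn_airyBound 2 hpos (abs_nonneg s)).const_mul _).add
      (((integrableOn_airyBound 0 hpos (abs_nonneg s)).const_mul _).const_mul _)) ?_).2
  · rwa [integral_sub (hω.integrableOn_airyIntegrand 2 q s)
      ((hω.integrableOn_airyIntegrand 0 q s).const_mul (s : ℂ)), integral_const_mul] at key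
  · refine (ae_restrict_mem measurableSet_Ioi).mono fun t ht x hx => ?_
    have hx' : |x| ≤ |q| + 1 := by
      rw [Metric.mem_ball, Real.dist_eq] at hx
      linarith [abs_sub_abs_le_abs_sub x q]
    have hb : ∀ n, ‖airyIntegrand ω n x s t‖ ≤
        Real.exp ((|q| + 1) * |s|) * airyBound n (|q| + 1) |s| t := fun n => by
      refine (hω.norm_airyIntegrand_le n hx' (neg_abs_le s) (le_of_lt ht)).trans ?_
      refine mul_le_mul_of_nonneg_right (Real.exp_le_exp.2 ?_) (Real.exp_pos _).le
      calc -(x * s) ≤ |x * s| := neg_le_abs _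
        _ = |x| * |s| := abs_mul _ _
        _ ≤ (|q| + 1) * |s| := by gcongr
    refine (norm_sub_le _ _).trans (add_le_add (hb 2) ?_)
    rw [norm_mul, Complex.norm_real, Real.norm_eq_abs]
    exact mul_le_mul_of_nonneg_left (hb 0) (abs_nonneg s)
  · refine Eventually.of_forall fun t x _ => ?_
    have h := hasDerivAt_exp_phase s ((hasDerivAt_id x).ofReal_comp.add_const (t * ω))
    have h' := h.mul_const ω
    simp only [id] at h'
    refine (h'.congr_deriv ?_).congr_of_eventuallyEq (Eventually.of_forall fun t => ?_)
    · simp only [airyIntegrand]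
      push_cast
      ring
    · simp [airyIntegrand]

end IsAiryDirection

/-! ### The Airy function -/

theorem isAiryDirection_exp : IsAiryDirection (Complex.exp (Real.pi / 3 * Complex.I)) := by
  have h : Complex.exp (Real.pi / 3 * Complex.I) = (1 / 2 : ℝ) + (√3 / 2 : ℝ) * Complex.I := by
    rw [Complex.exp_mul_I, ← Real.cos_pi_div_three, ← Real.sin_pi_div_three]
    push_cast
    rfl
  have h3 : ((√3 : ℝ) : ℂ) ^ 2 = 3 := by
    rw [← Complex.ofReal_pow, Real.sq_sqrt (by norm_num)]
    norm_num
  constructor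
  · rw [h]
    push_cast
    linear_combination (1 / 4 : ℂ) * Complex.I ^ 2 * h3 + (3 / 4 : ℂ) * Complex.I_sq
  · rw [h]
    simp

theorem IsAiryDirection.conj {ω : ℂ} (hω : IsAiryDirection ω) :
    IsAiryDirection ((starRingEnd ℂ) ω) :=
  ⟨by simpa using congrArg (starRingEnd ℂ) hω.sq_eq, by simpa using hω.re_eq⟩

theorem isAiryDirection_exp_neg :
    IsAiryDirection (Complex.exp (-(Real.pi / 3 * Complex.I))) := by
  convert isAiryDirection_exp.conj using 1
  simp [← Complex.exp_conj, map_ofNat]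

/-- `(1 / 2πi) ∫ ζ ^ n * exp (ζ ^ 3 / 3 - ζ * s) dζ` along the two rays with angles `± π / 3` issuing
from the real point `q`. -/
noncomputable def airyMoment (n : ℕ) (q s : ℝ) : ℂ :=
  1 / (2 * Real.pi * Complex.I) *
    (airyRay (Complex.exp (Real.pi / 3 * Complex.I)) n q s -
      airyRay (Complex.exp (-(Real.pi / 3 * Complex.I))) n q s)

theorem airyContour_eq_airyMoment (s : ℝ) : airyContour s = airyMoment 0 0 s := by
  simp [airyContour, airyMoment, rayIntegral, airyRay, airyIntegrand]

theorem hasDerivAt_airyMoment (n : ℕ) (q s : ℝ) :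
    HasDerivAt (fun s => airyMoment n q s) (-airyMoment (n + 1) q s) s := by
  refine (((isAiryDirection_exp.hasDerivAt_airyRay n q s).sub
    (isAiryDirection_exp_neg.hasDerivAt_airyRay n q s)).const_mul
      (1 / (2 * Real.pi * Complex.I) : ℂ)).congr_deriv ?_
  rw [airyMoment]
  ring

/-- Cauchy's theorem for the Airy contour: the vertex may be moved along the real axis. -/
theorem airyMoment_zero_eq (q s : ℝ) : airyMoment 0 q s = airyMoment 0 0 s := by
  have hd : ∀ q, HasDerivAt (fun q => airyMoment 0 q s) 0 q := fun q => by
    refine (((isAiryDirection_exp.hasDerivAt_airyRay_start q s).sub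
      (isAiryDirection_exp_neg.hasDerivAt_airyRay_start q s)).const_mul
        (1 / (2 * Real.pi * Complex.I) : ℂ)).congr_deriv ?_
    simp
  exact is_const_of_deriv_eq_zero (fun q => (hd q).differentiableAt) (fun q => (hd q).deriv) q 0

theorem airyMoment_one_eq (q s : ℝ) : airyMoment 1 q s = airyMoment 1 0 s := by
  have h := hasDerivAt_airyMoment 0 q s
  rw [show (fun s => airyMoment 0 q s) = fun s => airyMoment 0 0 s from
    funext fun s => airyMoment_zero_eq q s] at h
  exact neg_injective (h.unique (hasDerivAt_airyMoment 0 0 s))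

theorem airyMoment_two_eq (s : ℝ) : airyMoment 2 0 s = s * airyMoment 0 0 s := by
  have h1 := isAiryDirection_exp.airyRay_two_sub 0 s
  have h2 := isAiryDirection_exp_neg.airyRay_two_sub 0 s
  rw [airyMoment, airyMoment]
  linear_combination (1 / (2 * Real.pi * Complex.I) : ℂ) * (h1 - h2)

theorem exists_norm_airyMoment_le (n : ℕ) (q S : ℝ) :
    ∃ C : ℝ, 0 ≤ C ∧ ∀ s : ℝ, -S ≤ s → ‖airyMoment n q s‖ ≤ C * Real.exp (-(q * s)) := by
  obtain ⟨C₁, h1, hC₁⟩ := isAiryDirection_exp.exists_norm_airyRay_le n q S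
  obtain ⟨C₂, h2, hC₂⟩ := isAiryDirection_exp_neg.exists_norm_airyRay_le n q S
  refine ⟨‖(1 / (2 * Real.pi * Complex.I) : ℂ)‖ * (C₁ + C₂), by positivity, fun s hs => ?_⟩
  rw [airyMoment, norm_mul]
  exact (mul_le_mul_of_nonneg_left ((norm_sub_le _ _).trans (add_le_add (hC₁ s hs) (hC₂ s hs)))
    (norm_nonneg _)).trans_eq (by ring)

theorem airyAi_eq_re (s : ℝ) : airyAi s = (airyMoment 0 0 s).re := by
  rw [airyAi, airyContour_eq_airyMoment]

/-- The derivative of the Airy function, as a contour integral. -/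
noncomputable def airyAiDeriv (s : ℝ) : ℝ := -(airyMoment 1 0 s).re

theorem hasDerivAt_airyAi (s : ℝ) : HasDerivAt airyAi (airyAiDeriv s) s := by
  have h := Complex.reCLM.hasFDerivAt.comp_hasDerivAt s (hasDerivAt_airyMoment 0 0 s)
  rw [show airyAi = fun s => (airyMoment 0 0 s).re from funext airyAi_eq_re]
  simpa [airyAiDeriv, Function.comp_def] using h

theorem hasDerivAt_airyAiDeriv (s : ℝ) : HasDerivAt airyAiDeriv (s * airyAi s) s := by
  have h := (Complex.reCLM.hasFDerivAt.comp_hasDerivAt s (hasDerivAt_airyMoment 1 0 s)).neg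
  refine h.congr_deriv ?_
  simp [airyMoment_two_eq, airyAi_eq_re]

theorem continuous_airyAi : Continuous airyAi :=
  continuous_iff_continuousAt.2 fun s => (hasDerivAt_airyAi s).continuousAt

theorem continuous_airyAiDeriv : Continuous airyAiDeriv :=
  continuous_iff_continuousAt.2 fun s => (hasDerivAt_airyAiDeriv s).continuousAt

theorem exists_airy_le (S : ℝ) :
    ∃ C : ℝ, 0 ≤ C ∧ ∀ s : ℝ, -S ≤ s →
      |airyAi s| ≤ C * Real.exp (-s) ∧ |airyAiDeriv s| ≤ C * Real.exp (-s) := by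
  obtain ⟨C₁, h1, hC₁⟩ := exists_norm_airyMoment_le 0 1 S
  obtain ⟨C₂, h2, hC₂⟩ := exists_norm_airyMoment_le 1 1 S
  refine ⟨C₁ + C₂, by positivity, fun s hs => ⟨?_, ?_⟩⟩
  · have h := (Complex.abs_re_le_norm _).trans (hC₁ s hs)
    rw [airyMoment_zero_eq, ← airyAi_eq_re, one_mul] at h
    exact h.trans (by gcongr; linarith)
  · have h := (Complex.abs_re_le_norm _).trans (hC₂ s hs)
    rw [airyMoment_one_eq, one_mul] at h
    rw [airyAiDeriv, abs_neg]
    exact h.trans (by gcongr; linarith)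

/-! ### Asymptotics of the Airy function -/

/-- The ray integral through the saddle point, rescaled so that its quadratic part does not
depend on the parameter `ε`. -/
noncomputable def saddleRay (ω : ℂ) (ε : ℝ) : ℂ :=
  ∫ v in Set.Ioi (0 : ℝ), Complex.exp (ω ^ 2 * v ^ 2 - ε * v ^ 3 / 3) * ω

namespace IsAiryDirection

variable {ω : ℂ} (hω : IsAiryDirection ω)
include hω

/-- The vertex of the contour is placed at the saddle point `q` of `ζ ^ 3 / 3 - ζ * q ^ 2`. -/
theorem airyRay_saddle {q : ℝ} (hq : 0 < q) :
    airyRay ω 0 q (q ^ 2) =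
      Real.exp (-(2 / 3 * q ^ 3)) * ((√q)⁻¹ * saddleRay ω ((√q)⁻¹ ^ 3)) := by
  have hs : 0 < √q := Real.sqrt_pos.2 hq
  have h := integral_comp_mul_left_Ioi
    (fun v : ℝ => Complex.exp (ω ^ 2 * v ^ 2 - ((√q)⁻¹ ^ 3 : ℝ) * v ^ 3 / 3) * ω) 0 hs
  rw [mul_zero, Complex.real_smul] at h
  rw [saddleRay, ← h, airyRay, ← integral_const_mul]
  congr 1
  funext t
  have hsq : ((√q : ℝ) : ℂ) ^ 2 = q := by rw [← Complex.ofReal_pow, Real.sq_sqrt hq.le]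
  have hs0 : ((√q : ℝ) : ℂ) ≠ 0 := Complex.ofReal_ne_zero.2 hs.ne'
  rw [airyIntegrand, pow_zero, one_mul, ← mul_assoc, Complex.ofReal_exp, ← Complex.exp_add]
  congr 2
  push_cast
  rw [mul_pow, mul_pow, hsq, inv_pow, inv_mul_cancel_left₀ (pow_ne_zero 3 hs0)]
  linear_combination (t ^ 3 / 3 : ℂ) * hω.cube_eq

theorem norm_saddleIntegrand_le {ε v : ℝ} (hε : 0 ≤ ε) (hv : 0 ≤ v) :
    ‖Complex.exp (ω ^ 2 * v ^ 2 - ε * v ^ 3 / 3) * ω‖ ≤ Real.exp (-(1 / 2) * v ^ 2) := by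
  rw [norm_mul, hω.norm_eq, mul_one, Complex.norm_exp, hω.sq_eq,
    show (ω - 1) * v ^ 2 - ε * v ^ 3 / 3 =
      ((v ^ 2 : ℝ) : ℂ) * ω + ((-v ^ 2 - ε * v ^ 3 / 3 : ℝ) : ℂ) by push_cast; ring,
    Complex.add_re, Complex.re_ofReal_mul, Complex.ofReal_re, hω.re_eq]
  have : 0 ≤ ε * v ^ 3 := by positivity
  exact Real.exp_le_exp.2 (by linarith)

theorem norm_saddleRay_le {ε : ℝ} (hε : 0 ≤ ε) :
    ‖saddleRay ω ε‖ ≤ ∫ v in Set.Ioi (0 : ℝ), Real.exp (-(1 / 2) * v ^ 2) := by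
  refine norm_integral_le_of_norm_le (integrable_exp_neg_mul_sq (by norm_num)).integrableOn ?_
  exact (ae_restrict_mem measurableSet_Ioi).mono fun v hv =>
    hω.norm_saddleIntegrand_le hε (le_of_lt hv)

theorem tendsto_saddleRay : Tendsto (saddleRay ω) (𝓝[>] 0) (𝓝 (saddleRay ω 0)) := by
  refine tendsto_integral_filter_of_dominated_convergence
    (fun v => Real.exp (-(1 / 2) * v ^ 2)) ?_ ?_
    (integrable_exp_neg_mul_sq (by norm_num)).integrableOn ?_
  · exact Eventually.of_forall fun ε => Continuous.aestronglyMeasurable (by fun_prop)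
  · filter_upwards [self_mem_nhdsWithin] with ε hε
    exact (ae_restrict_mem measurableSet_Ioi).mono fun v hv =>
      hω.norm_saddleIntegrand_le (le_of_lt hε) (le_of_lt hv)
  · refine Eventually.of_forall fun v => ?_
    have hc : Continuous fun ε : ℝ => Complex.exp (ω ^ 2 * v ^ 2 - ε * v ^ 3 / 3) * ω := by
      fun_prop
    exact (hc.tendsto 0).mono_left nhdsWithin_le_nhds

end IsAiryDirection

/-- At `ε = 0` the saddle point integral is a complex Gaussian integral. -/
theorem saddleRay_zero {x : ℝ} (hω : IsAiryDirection (Complex.exp (x * Complex.I)))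
    (hx : |x| < Real.pi) :
    saddleRay (Complex.exp (x * Complex.I)) 0 =
      √Real.pi / 2 * Complex.exp (3 * x / 2 * Complex.I) := by
  set ω := Complex.exp (x * Complex.I) with hωdef
  have hre : 0 < (-ω ^ 2).re := by
    rw [hω.sq_eq]
    simp [hω.re_eq]
    norm_num
  have hdiv : (Real.pi : ℂ) / -ω ^ 2 = Complex.exp (Real.log Real.pi + x * Complex.I) := by
    rw [Complex.exp_add, ← Complex.ofReal_exp, Real.exp_log Real.pi_pos, ← hωdef,
      div_eq_iff (fun h => by simp [h] at hre)]
    linear_combination (Real.pi : ℂ) * hω.cube_eq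
  have hlog : Complex.log (Complex.exp (Real.log Real.pi + x * Complex.I)) =
      Real.log Real.pi + x * Complex.I := by
    refine Complex.log_exp ?_ ?_ <;> simp
    · exact (abs_lt.1 hx).1
    · exact (abs_lt.1 hx).2.le
  have hg := integral_gaussian_complex_Ioi hre
  rw [hdiv, Complex.cpow_def_of_ne_zero (Complex.exp_ne_zero _), hlog] at hg
  have hsqrt : ((√Real.pi : ℝ) : ℂ) = Complex.exp (Real.log Real.pi * (1 / 2)) := by
    rw [Real.sqrt_eq_rpow, Real.rpow_def_of_pos Real.pi_pos]
    push_cast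
    rfl
  calc saddleRay ω 0 = (∫ v : ℝ in Set.Ioi 0, Complex.exp (-(-ω ^ 2) * (v : ℂ) ^ 2)) * ω := by
        rw [saddleRay, ← integral_mul_const]
        simp
    _ = √Real.pi / 2 * Complex.exp (3 * x / 2 * Complex.I) := by
        rw [hg, hsqrt, hωdef, div_mul_eq_mul_div, div_mul_eq_mul_div, ← Complex.exp_add,
          ← Complex.exp_add]
        congr 2
        ring

/-- The factor by which `airyAi (q ^ 2)` differs from `exp (-2 q ^ 3 / 3) / √q`, as a function of
`ε = q ^ (-3 / 2)`. -/
noncomputable def airyAmplitude (ε : ℝ) : ℝ :=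
  (1 / (2 * Real.pi * Complex.I) *
    (saddleRay (Complex.exp (Real.pi / 3 * Complex.I)) ε -
      saddleRay (Complex.exp (-(Real.pi / 3 * Complex.I))) ε)).re

theorem airyAi_sq {q : ℝ} (hq : 0 < q) :
    airyAi (q ^ 2) = Real.exp (-(2 / 3 * q ^ 3)) * ((√q)⁻¹ * airyAmplitude ((√q)⁻¹ ^ 3)) := by
  rw [airyAi_eq_re, ← airyMoment_zero_eq q, airyMoment, isAiryDirection_exp.airyRay_saddle hq,
    isAiryDirection_exp_neg.airyRay_saddle hq, airyAmplitude, ← Complex.re_ofReal_mul,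
    ← Complex.re_ofReal_mul]
  congr 1
  push_cast
  ring

theorem exists_abs_airyAmplitude_le : ∃ C : ℝ, ∀ ε : ℝ, 0 ≤ ε → |airyAmplitude ε| ≤ C := by
  set I := ∫ v in Set.Ioi (0 : ℝ), Real.exp (-(1 / 2) * v ^ 2)
  refine ⟨‖(1 / (2 * Real.pi * Complex.I) : ℂ)‖ * (I + I),
    fun ε hε => (Complex.abs_re_le_norm _).trans ?_⟩
  rw [norm_mul]
  exact mul_le_mul_of_nonneg_left ((norm_sub_le _ _).trans (add_le_add
    (isAiryDirection_exp.norm_saddleRay_le hε)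
    (isAiryDirection_exp_neg.norm_saddleRay_le hε))) (norm_nonneg _)

theorem tendsto_airyAmplitude :
    Tendsto airyAmplitude (𝓝[>] 0) (𝓝 (1 / (2 * √Real.pi))) := by
  have hpi := Real.pi_pos
  have h := Complex.continuous_re.continuousAt.tendsto.comp
    ((isAiryDirection_exp.tendsto_saddleRay.sub
      isAiryDirection_exp_neg.tendsto_saddleRay).const_mul (1 / (2 * Real.pi * Complex.I) : ℂ))
  suffices e : 1 / (2 * √Real.pi) = (1 / (2 * Real.pi * Complex.I) *
      (saddleRay (Complex.exp (Real.pi / 3 * Complex.I)) 0 -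
        saddleRay (Complex.exp (-(Real.pi / 3 * Complex.I))) 0)).re by
    rw [e]
    exact h
  have e1 : Complex.exp (Real.pi / 3 * Complex.I) =
      Complex.exp ((Real.pi / 3 : ℝ) * Complex.I) := by push_cast; rfl
  have e2 : Complex.exp (-(Real.pi / 3 * Complex.I)) =
      Complex.exp ((-(Real.pi / 3) : ℝ) * Complex.I) := by push_cast; ring_nf
  have hlt : |Real.pi / 3| < Real.pi := by rw [abs_of_pos (by positivity)]; linarith
  have s1 := saddleRay_zero (e1 ▸ isAiryDirection_exp) hlt
  have s2 := saddleRay_zero (e2 ▸ isAiryDirection_exp_neg) (by rwa [abs_neg])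
  rw [e1, e2, s1, s2]
  have x1 : Complex.exp (3 * (Real.pi / 3 : ℝ) / 2 * Complex.I) = Complex.I := by
    refine Eq.trans (congrArg Complex.exp ?_) Complex.exp_pi_div_two_mul_I
    push_cast
    ring
  have x2 : Complex.exp (3 * (-(Real.pi / 3) : ℝ) / 2 * Complex.I) = -Complex.I := by
    refine Eq.trans (congrArg Complex.exp ?_) Complex.exp_neg_pi_div_two_mul_I
    push_cast
    ring
  rw [x1, x2, show (1 / (2 * Real.pi * Complex.I) : ℂ) *
      (√Real.pi / 2 * Complex.I - √Real.pi / 2 * -Complex.I) =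
        ((√Real.pi / (2 * Real.pi) : ℝ) : ℂ) by
    have := Complex.I_ne_zero
    have : (Real.pi : ℂ) ≠ 0 := Complex.ofReal_ne_zero.2 hpi.ne'
    push_cast
    field_simp
    ring, Complex.ofReal_re]
  have := Real.sqrt_pos.2 hpi
  nth_rewrite 3 [← Real.sq_sqrt hpi.le]
  field_simp

theorem tendsto_inv_sqrt_pow : Tendsto (fun q : ℝ => (√q)⁻¹ ^ 3) atTop (𝓝[>] 0) := by
  refine tendsto_nhdsWithin_iff.2 ⟨?_, ?_⟩
  · simpa using (tendsto_inv_atTop_zero.comp Real.tendsto_sqrt_atTop).pow 3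
  · filter_upwards [eventually_gt_atTop 0] with q hq
    have := Real.sqrt_pos.2 hq
    exact Set.mem_Ioi.2 (by positivity)

theorem eventually_airyAi_pos : ∀ᶠ s in atTop, 0 < airyAi s := by
  have h := (tendsto_airyAmplitude.comp tendsto_inv_sqrt_pow).comp Real.tendsto_sqrt_atTop
  filter_upwards [h.eventually_const_lt (u := 0) (by have := Real.pi_pos; positivity),
    eventually_gt_atTop 0] with s hs hs0
  have hq := Real.sqrt_pos.2 hs0
  have hq' := Real.sqrt_pos.2 hq
  have e := airyAi_sq hq
  rw [Real.sq_sqrt hs0.le] at e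
  rw [e]
  have : 0 < airyAmplitude ((√√s)⁻¹ ^ 3) := hs
  positivity

/-! ### The first zero of the Airy function -/

/-- Sturm comparison of the Airy equation with `w'' = -w` on an interval of length `π`. -/
theorem exists_airyAi_eq_zero : ∃ s, airyAi s = 0 := by
  by_contra! hne
  have hpi := Real.pi_pos
  -- A continuous function without zeros has constant sign.
  have hsign : ∀ x, 0 < airyAi (-1) * airyAi x := by
    intro x
    by_contra! hx
    have h0 : 0 ≤ airyAi (-1) * airyAi (-1) := mul_self_nonneg _
    obtain ⟨y, hy⟩ := mem_range_of_exists_le_of_exists_ge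
      (continuous_airyAi.const_mul (airyAi (-1))) ⟨x, hx⟩ ⟨-1, h0⟩
    exact (mul_ne_zero (hne (-1)) (hne y)) hy
  set k := airyAi (-1)
  -- The Wronskian with `-sin (x + 1)`, which is positive on `(-1 - π, -1)` and zero at its ends.
  have hd : ∀ x, HasDerivAt
      (fun x => k * (airyAiDeriv x * -Real.sin (x + 1) - airyAi x * -Real.cos (x + 1)))
      ((x + 1) * (k * airyAi x) * -Real.sin (x + 1)) x := fun x => by
    have h1 := ((hasDerivAt_id x).add_const 1).sin.neg
    have h2 := ((hasDerivAt_id x).add_const 1).cos.neg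
    refine ((((hasDerivAt_airyAiDeriv x).mul h1).sub
      ((hasDerivAt_airyAi x).mul h2)).const_mul k).congr_deriv ?_
    simp
    ring
  have hanti : AntitoneOn
      (fun x => k * (airyAiDeriv x * -Real.sin (x + 1) - airyAi x * -Real.cos (x + 1)))
      (Set.Icc (-1 - Real.pi) (-1)) := by
    refine antitoneOn_of_deriv_nonpos (convex_Icc _ _)
      (fun x _ => (hd x).continuousAt.continuousWithinAt)
      (fun x _ => (hd x).differentiableAt.differentiableWithinAt) fun x hx => ?_
    rw [interior_Icc] at hx
    rw [(hd x).deriv]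
    have hsin : Real.sin (x + 1) ≤ 0 :=
      Real.sin_nonpos_of_nonpos_of_neg_pi_le (by linarith [hx.2]) (by linarith [hx.1])
    have := mul_nonneg (mul_nonneg (by linarith [hx.2] : 0 ≤ -(x + 1)) (hsign x).le)
      (neg_nonneg.2 hsin)
    linarith
  have h := hanti (Set.left_mem_Icc.2 (by linarith)) (Set.right_mem_Icc.2 (by linarith))
    (by linarith)
  have e1 : -1 - Real.pi + 1 = -Real.pi := by ring
  simp [e1] at h
  linarith [hsign (-1 - Real.pi), hsign (-1)]

theorem isGreatest_airyFirstZero : IsGreatest {s : ℝ | airyAi s = 0} airyFirstZero := by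
  have hbdd : BddAbove {s : ℝ | airyAi s = 0} := by
    obtain ⟨S, hS⟩ := eventually_atTop.1 eventually_airyAi_pos
    refine ⟨S, fun s hs => ?_⟩
    by_contra! h
    exact (hS s h.le).ne' hs
  exact ⟨(isClosed_singleton.preimage continuous_airyAi).csSup_mem exists_airyAi_eq_zero hbdd,
    fun s hs => le_csSup hbdd hs⟩

theorem airyAi_pos_of_airyFirstZero_lt {s : ℝ} (hs : airyFirstZero < s) : 0 < airyAi s := by
  by_contra! h
  obtain ⟨t, ht, hst⟩ := (eventually_airyAi_pos.and (eventually_ge_atTop s)).exists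
  obtain ⟨z, hz, hz0⟩ := intermediate_value_Icc hst continuous_airyAi.continuousOn ⟨h, ht.le⟩
  exact (isGreatest_airyFirstZero.2 hz0).not_gt (hs.trans_le hz.1)

/-! ### Gaussian bounds -/

/-- For `|x| ≤ R`, the function `f x z` is bounded by a multiple of `exp (b * |z| - κ * z ^ 2)`, for
some `b` that may depend on `R`. For `κ = 0` this allows exponential growth in `z`. -/
def GaussianBound (R κ : ℝ) (f : ℝ → ℝ → ℝ) : Prop :=
  ∃ C b : ℝ, 0 ≤ C ∧ 0 ≤ b ∧
    ∀ x z : ℝ, |x| ≤ R → |f x z| ≤ C * Real.exp (b * |z| - κ * z ^ 2)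

namespace GaussianBound

variable {R κ : ℝ} {f g : ℝ → ℝ → ℝ}

theorem add (hf : GaussianBound R κ f) (hg : GaussianBound R κ g) :
    GaussianBound R κ fun x z => f x z + g x z := by
  obtain ⟨C₁, b₁, hC₁, hb₁, h₁⟩ := hf
  obtain ⟨C₂, b₂, hC₂, hb₂, h₂⟩ := hg
  refine ⟨C₁ + C₂, b₁ + b₂, by positivity, by positivity, fun x z hx => ?_⟩
  have hz := abs_nonneg z
  rw [add_mul]
  refine (abs_add_le _ _).trans (add_le_add ((h₁ x z hx).trans ?_) ((h₂ x z hx).trans ?_)) <;>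
    gcongr <;> linarith

theorem mul (hf : GaussianBound R 0 f) (hg : GaussianBound R κ g) :
    GaussianBound R κ fun x z => f x z * g x z := by
  obtain ⟨C₁, b₁, hC₁, hb₁, h₁⟩ := hf
  obtain ⟨C₂, b₂, hC₂, hb₂, h₂⟩ := hg
  refine ⟨C₁ * C₂, b₁ + b₂, by positivity, by positivity, fun x z hx => ?_⟩
  rw [abs_mul]
  refine (mul_le_mul (h₁ x z hx) (h₂ x z hx) (abs_nonneg _) (by positivity)).trans_eq ?_
  rw [mul_mul_mul_comm, ← Real.exp_add]
  ring_nf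

theorem pow (hf : GaussianBound R 0 f) (n : ℕ) : GaussianBound R 0 fun x z => f x z ^ n := by
  induction n with
  | zero => exact ⟨1, 0, zero_le_one, le_rfl, fun x z _ => by simp⟩
  | succ n ih => simpa only [pow_succ] using ih.mul hf

theorem const (c : ℝ) : GaussianBound R 0 fun _ _ => c :=
  ⟨|c|, 0, abs_nonneg c, le_rfl, fun x z _ => by simp⟩

theorem fst : GaussianBound R 0 fun x _ => x :=
  ⟨|R|, 0, abs_nonneg R, le_rfl, fun x z hx => by simpa using hx.trans (le_abs_self R)⟩

theorem snd : GaussianBound R 0 fun _ z => z :=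
  ⟨1, 1, zero_le_one, zero_le_one, fun x z _ => by
    simpa using (le_add_of_nonneg_right zero_le_one).trans (Real.add_one_le_exp |z|)⟩

theorem exists_le_gaussian (hκ : 0 < κ) (hf : GaussianBound R κ f) :
    ∃ C : ℝ, ∀ x z : ℝ, |x| ≤ R → |f x z| ≤ C * Real.exp (-(κ / 2) * z ^ 2) := by
  obtain ⟨C, b, hC, hb, h⟩ := hf
  refine ⟨C * Real.exp (b ^ 2 / (2 * κ)), fun x z hx => (h x z hx).trans ?_⟩
  rw [mul_assoc, ← Real.exp_add]
  refine mul_le_mul_of_nonneg_left (Real.exp_le_exp.2 ?_) hC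
  have e : b ^ 2 / (2 * κ) + -(κ / 2) * z ^ 2 - (b * |z| - κ * z ^ 2) =
      (b - κ * |z|) ^ 2 / (2 * κ) := by
    field_simp
    rw [← sq_abs z]
    ring
  have : 0 ≤ (b - κ * |z|) ^ 2 / (2 * κ) := by positivity
  linarith

theorem integrable (hκ : 0 < κ) (hf : GaussianBound R κ f) {x : ℝ} (hx : |x| ≤ R)
    (hc : Continuous (f x)) : Integrable (f x) := by
  obtain ⟨C, hC⟩ := hf.exists_le_gaussian hκ
  exact ((integrable_exp_neg_mul_sq (half_pos hκ)).const_mul C).mono'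
    hc.aestronglyMeasurable (Eventually.of_forall fun z => hC x z hx)

theorem tendsto_zero (hκ : 0 < κ) (hf : GaussianBound R κ f) {x : ℝ} (hx : |x| ≤ R) :
    Tendsto (f x) (cocompact ℝ) (𝓝 0) := by
  obtain ⟨C, hC⟩ := hf.exists_le_gaussian hκ
  refine squeeze_zero_norm (fun z => hC x z hx) ?_
  have h : Tendsto (fun z : ℝ => Real.exp (-(κ / 2) * z ^ 2)) (cocompact ℝ) (𝓝 0) := by
    refine Real.tendsto_exp_atBot.comp ?_
    refine Tendsto.const_mul_atTop_of_neg (by linarith) ?_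
    simpa [Function.comp_def] using
      (tendsto_pow_atTop (α := ℝ) two_ne_zero).comp (tendsto_norm_cocompact_atTop (E := ℝ))
  simpa using h.const_mul C

/-- Differentiation under the integral sign. -/
theorem hasDerivAt_integral {f' : ℝ → ℝ → ℝ} (hκ : 0 < κ) (hf : ∀ R, GaussianBound R κ f)
    (hf' : ∀ R, GaussianBound R κ f') (hc : ∀ x, Continuous (f x)) (hc' : ∀ x, Continuous (f' x))
    (hd : ∀ x z, HasDerivAt (fun x => f x z) (f' x z) x) (x : ℝ) :
    HasDerivAt (fun x => ∫ z, f x z) (∫ z, f' x z) x := by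
  obtain ⟨C, hC⟩ := (hf' (|x| + 1)).exists_le_gaussian hκ
  refine (hasDerivAt_integral_of_dominated_loc_of_deriv_le (F := f) (F' := f')
    (Metric.ball_mem_nhds x one_pos)
    (Eventually.of_forall fun x => (hc x).aestronglyMeasurable)
    ((hf |x|).integrable hκ le_rfl (hc x)) (hc' x).aestronglyMeasurable
    (Eventually.of_forall fun z t ht => hC t z ?_)
    ((integrable_exp_neg_mul_sq (half_pos hκ)).const_mul C)
    (Eventually.of_forall fun z t _ => hd t z)).2
  rw [Metric.mem_ball, Real.dist_eq] at ht
  linarith [abs_sub_abs_le_abs_sub t x]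

end GaussianBound

/-! ### The kernel and its differential equation -/

/-- The kernel in the parameters `m = (lam / 8) ^ (1 / 6)` and `α = a / (4 * m ^ 6)`. -/
noncomputable def scaledKernel (m α x y z : ℝ) : ℝ :=
  2 * m ^ 2 * Real.exp (2 * m ^ 3 * x * y * z) * airyAi (m ^ 2 * (x ^ 2 + y ^ 2 + z ^ 2 + α))

/-- The companion of `scaledKernel` with `airyAi` replaced by its derivative. -/
noncomputable def scaledKernelAux (m α x y z : ℝ) : ℝ :=
  2 * m ^ 2 * Real.exp (2 * m ^ 3 * x * y * z) *
    airyAiDeriv (m ^ 2 * (x ^ 2 + y ^ 2 + z ^ 2 + α))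

/-- The first derivative of `scaledKernel` in its first variable. -/
noncomputable def scaledKernelDeriv (m α x y z : ℝ) : ℝ :=
  2 * m ^ 3 * y * z * scaledKernel m α x y z + 2 * m ^ 2 * x * scaledKernelAux m α x y z

/-- The quartic potential in the parameters of `scaledKernel`. -/
noncomputable def potential (m α x : ℝ) : ℝ := 4 * m ^ 6 * (α * x ^ 2 + x ^ 4)

/-- The function `K_xx - V(x) K` for the kernel `K`. That it is symmetric in the three variables is
what makes the product formula work. -/
noncomputable def schrodingerKernel (m α x y z : ℝ) : ℝ :=
  4 * m ^ 6 * (x ^ 2 * y ^ 2 + y ^ 2 * z ^ 2 + x ^ 2 * z ^ 2) * scaledKernel m α x y z +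
    (8 * m ^ 5 * x * y * z + 2 * m ^ 2) * scaledKernelAux m α x y z

theorem scaledKernel_swap (x y z : ℝ) : scaledKernel m α x y z = scaledKernel m α z y x := by
  unfold scaledKernel
  ring_nf

theorem schrodingerKernel_swap (x y z : ℝ) :
    schrodingerKernel m α x y z = schrodingerKernel m α z y x := by
  unfold schrodingerKernel scaledKernel scaledKernelAux
  ring_nf

theorem continuous_scaledKernel (x y : ℝ) : Continuous (scaledKernel m α x y) := by
  unfold scaledKernel
  exact (by fun_prop : Continuous _).mul (continuous_airyAi.comp (by fun_prop))

theorem continuous_scaledKernelAux (x y : ℝ) : Continuous (scaledKernelAux m α x y) := by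
  unfold scaledKernelAux
  exact (by fun_prop : Continuous _).mul (continuous_airyAiDeriv.comp (by fun_prop))

theorem continuous_scaledKernelDeriv (x y : ℝ) : Continuous (scaledKernelDeriv m α x y) :=
  ((by fun_prop : Continuous _).mul (continuous_scaledKernel x y)).add
    ((by fun_prop : Continuous _).mul (continuous_scaledKernelAux x y))

theorem continuous_schrodingerKernel (x y : ℝ) : Continuous (schrodingerKernel m α x y) :=
  ((by fun_prop : Continuous _).mul (continuous_scaledKernel x y)).add
    ((by fun_prop : Continuous _).mul (continuous_scaledKernelAux x y))

theorem hasDerivAt_exp_kernel (x y z : ℝ) :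
    HasDerivAt (fun x => 2 * m ^ 2 * Real.exp (2 * m ^ 3 * x * y * z))
      (2 * m ^ 3 * y * z * (2 * m ^ 2 * Real.exp (2 * m ^ 3 * x * y * z))) x := by
  have h := (((((hasDerivAt_id x).const_mul (2 * m ^ 3)).mul_const y).mul_const z).exp).const_mul
    (2 * m ^ 2)
  refine h.congr_deriv ?_
  simp only [id]
  ring

theorem hasDerivAt_airyArgument (x y z : ℝ) :
    HasDerivAt (fun x => m ^ 2 * (x ^ 2 + y ^ 2 + z ^ 2 + α)) (2 * m ^ 2 * x) x := by
  have h := (((((hasDerivAt_id x).pow 2).add_const (y ^ 2)).add_const (z ^ 2)).add_const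
    α).const_mul (m ^ 2)
  refine h.congr_deriv ?_
  simp
  ring

theorem hasDerivAt_scaledKernel (x y z : ℝ) :
    HasDerivAt (fun x => scaledKernel m α x y z) (scaledKernelDeriv m α x y z) x := by
  refine ((hasDerivAt_exp_kernel x y z).mul
    ((hasDerivAt_airyAi _).comp x (hasDerivAt_airyArgument (α := α) x y z))).congr_deriv ?_
  simp only [scaledKernelDeriv, scaledKernel, scaledKernelAux, Function.comp_apply]
  ring

theorem hasDerivAt_scaledKernelAux (x y z : ℝ) :
    HasDerivAt (fun x => scaledKernelAux m α x y z)
      (2 * m ^ 3 * y * z * scaledKernelAux m α x y z +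
        2 * m ^ 4 * x * (x ^ 2 + y ^ 2 + z ^ 2 + α) * scaledKernel m α x y z) x := by
  refine ((hasDerivAt_exp_kernel x y z).mul
    ((hasDerivAt_airyAiDeriv _).comp x (hasDerivAt_airyArgument (α := α) x y z))).congr_deriv ?_
  simp only [scaledKernel, scaledKernelAux, Function.comp_apply]
  ring

theorem hasDerivAt_scaledKernelDeriv (x y z : ℝ) :
    HasDerivAt (fun x => scaledKernelDeriv m α x y z)
      (schrodingerKernel m α x y z + potential m α x * scaledKernel m α x y z) x := by
  refine (((hasDerivAt_scaledKernel x y z).const_mul (2 * m ^ 3 * y * z)).add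
    (((hasDerivAt_id x).const_mul (2 * m ^ 2)).mul
      (hasDerivAt_scaledKernelAux (α := α) x y z))).congr_deriv ?_
  simp only [scaledKernelDeriv, schrodingerKernel, potential, id]
  ring

theorem gaussianBound_airy {G : ℝ → ℝ} {C : ℝ} (hC : 0 ≤ C)
    (hG : ∀ s, -(m ^ 2 * |α|) ≤ s → |G s| ≤ C * Real.exp (-s)) (hm : 0 < m) (R y : ℝ) :
    GaussianBound R (m ^ 2) fun x z =>
      2 * m ^ 2 * Real.exp (2 * m ^ 3 * x * y * z) * G (m ^ 2 * (x ^ 2 + y ^ 2 + z ^ 2 + α)) := by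
  refine ⟨2 * m ^ 2 * (C * Real.exp (m ^ 2 * |α|)), 2 * m ^ 3 * |R| * |y|, by positivity,
    by positivity, fun x z hx => ?_⟩
  have hα := mul_le_mul_of_nonneg_left (neg_abs_le α) (sq_nonneg m)
  have h0 : 0 ≤ m ^ 2 * (x ^ 2 + y ^ 2) := by positivity
  have h1 : 0 ≤ m ^ 2 * z ^ 2 := by positivity
  have hxyz : 2 * m ^ 3 * x * y * z ≤ 2 * m ^ 3 * |R| * |y| * |z| := by
    calc 2 * m ^ 3 * x * y * z ≤ |2 * m ^ 3 * x * y * z| := le_abs_self _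
      _ = 2 * m ^ 3 * |x| * |y| * |z| := by
        simp only [abs_mul, abs_pow, abs_of_pos hm, abs_two]
      _ ≤ 2 * m ^ 3 * |R| * |y| * |z| := by
        have hx' : |x| ≤ |R| := hx.trans (le_abs_self R)
        exact mul_le_mul_of_nonneg_right (mul_le_mul_of_nonneg_right
          (mul_le_mul_of_nonneg_left hx' (by positivity)) (abs_nonneg y)) (abs_nonneg z)
  rw [abs_mul, abs_of_nonneg (by positivity : 0 ≤ 2 * m ^ 2 * Real.exp (2 * m ^ 3 * x * y * z))]
  calc 2 * m ^ 2 * Real.exp (2 * m ^ 3 * x * y * z) * |G (m ^ 2 * (x ^ 2 + y ^ 2 + z ^ 2 + α))|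
      ≤ 2 * m ^ 2 * Real.exp (2 * m ^ 3 * |R| * |y| * |z|) *
        (C * Real.exp (m ^ 2 * |α| + -(m ^ 2 * z ^ 2))) := by
        gcongr
        refine (hG _ (by linarith)).trans ?_
        gcongr
        linarith
    _ = _ := by
        rw [sub_eq_add_neg, Real.exp_add, Real.exp_add]
        ring

theorem gaussianBound_scaledKernel (hm : 0 < m) (R y : ℝ) :
    GaussianBound R (m ^ 2) fun x z => scaledKernel m α x y z := by
  obtain ⟨C, hC, h⟩ := exists_airy_le (m ^ 2 * |α|)
  exact gaussianBound_airy hC (fun s hs => (h s hs).1) hm R y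

theorem gaussianBound_scaledKernelAux (hm : 0 < m) (R y : ℝ) :
    GaussianBound R (m ^ 2) fun x z => scaledKernelAux m α x y z := by
  obtain ⟨C, hC, h⟩ := exists_airy_le (m ^ 2 * |α|)
  exact gaussianBound_airy hC (fun s hs => (h s hs).2) hm R y

theorem gaussianBound_scaledKernelDeriv (hm : 0 < m) (R y : ℝ) :
    GaussianBound R (m ^ 2) fun x z => scaledKernelDeriv m α x y z :=
  (((GaussianBound.const (2 * m ^ 3 * y)).mul .snd).mul (gaussianBound_scaledKernel hm R y)).add
    (((GaussianBound.const (2 * m ^ 2)).mul .fst).mul (gaussianBound_scaledKernelAux hm R y))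

theorem gaussianBound_scaledKernelDeriv_swap (hm : 0 < m) (R y : ℝ) :
    GaussianBound R (m ^ 2) fun x z => scaledKernelDeriv m α z y x := by
  have h := (((GaussianBound.const (2 * m ^ 3 * y)).mul .fst).mul
    (gaussianBound_scaledKernel (α := α) hm R y)).add
    (((GaussianBound.const (2 * m ^ 2)).mul .snd).mul
      (gaussianBound_scaledKernelAux (α := α) hm R y))
  convert h using 3 with x z
  unfold scaledKernelDeriv scaledKernel scaledKernelAux
  ring_nf

theorem gaussianBound_schrodingerKernel (hm : 0 < m) (R y : ℝ) :
    GaussianBound R (m ^ 2) fun x z => schrodingerKernel m α x y z := by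
  have hx : GaussianBound R 0 fun x _ => x := .fst
  have hz : GaussianBound R 0 fun _ z => z := .snd
  have hy : GaussianBound R 0 fun _ _ => y := .const y
  exact (((GaussianBound.const (4 * m ^ 6)).mul ((((hx.pow 2).mul (hy.pow 2)).add
    ((hy.pow 2).mul (hz.pow 2))).add ((hx.pow 2).mul (hz.pow 2)))).mul
      (gaussianBound_scaledKernel hm R y)).add
    ((((((GaussianBound.const (8 * m ^ 5)).mul hx).mul hy).mul hz).add (.const (2 * m ^ 2))).mul
      (gaussianBound_scaledKernelAux hm R y))

theorem gaussianBound_potential_snd (R : ℝ) :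
    GaussianBound R 0 fun _ z => potential m α z := by
  have hz : GaussianBound R 0 fun _ z => z := .snd
  exact (GaussianBound.const (4 * m ^ 6)).mul (((GaussianBound.const α).mul (hz.pow 2)).add
    (hz.pow 4))

theorem gaussianBound_potential_fst (R : ℝ) :
    GaussianBound R 0 fun x _ => potential m α x := by
  have hx : GaussianBound R 0 fun x _ => x := .fst
  exact (GaussianBound.const (4 * m ^ 6)).mul (((GaussianBound.const α).mul (hx.pow 2)).add
    (hx.pow 4))

/-! ### The integral transform of a solution solves the same equation -/

/-- `ψ`, with derivative `ψ'`, solves `ψ'' = (V - E) ψ` and is bounded. -/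
structure IsBoundedSolution (m α E : ℝ) (ψ ψ' : ℝ → ℝ) : Prop where
  hasDerivAt : ∀ x, HasDerivAt ψ (ψ' x) x
  hasDerivAt_deriv : ∀ x, HasDerivAt ψ' ((potential m α x - E) * ψ x) x
  bounded : ∃ M, ∀ x, |ψ x| ≤ M

namespace IsBoundedSolution

variable {E : ℝ} {ψ ψ' : ℝ → ℝ} (hψ : IsBoundedSolution m α E ψ ψ')
include hψ

theorem continuous : Continuous ψ :=
  continuous_iff_continuousAt.2 fun x => (hψ.hasDerivAt x).continuousAt

theorem gaussianBound (R : ℝ) : GaussianBound R 0 fun _ z => ψ z := by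
  obtain ⟨M, hM⟩ := hψ.bounded
  exact ⟨M, 0, (abs_nonneg _).trans (hM 0), le_rfl, fun x z _ => by simpa using hM z⟩

/-- The derivative grows at most exponentially, because `ψ''` does by the equation. -/
theorem gaussianBound_deriv (R : ℝ) : GaussianBound R 0 fun _ z => ψ' z := by
  obtain ⟨C, b, hC, hb, h⟩ := ((gaussianBound_potential_snd (m := m) (α := α) |R|).add
    (.const (-E))).mul (hψ.gaussianBound |R|)
  have hdiff : GaussianBound R 0 fun _ z => ψ' z - ψ' 0 := by
    refine ⟨C, b + 1, hC, by positivity, fun x z _ => ?_⟩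
    have key := Convex.norm_image_sub_le_of_norm_hasDerivWithin_le (f := ψ')
      (f' := fun t => (potential m α t - E) * ψ t) (s := Set.Icc (-|z|) |z|)
      (C := C * Real.exp (b * |z|)) (x := 0) (y := z)
      (fun t _ => (hψ.hasDerivAt_deriv t).hasDerivWithinAt) ?_ (convex_Icc _ _)
      ⟨by simp, by simp⟩ ⟨neg_abs_le z, le_abs_self z⟩
    · rw [Real.norm_eq_abs, Real.norm_eq_abs, sub_zero] at key
      refine key.trans ?_
      have h1 : |z| ≤ Real.exp |z| := by linarith [Real.add_one_le_exp |z|]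
      calc C * Real.exp (b * |z|) * |z| ≤ C * Real.exp (b * |z|) * Real.exp |z| := by gcongr
        _ = C * Real.exp ((b + 1) * |z| - 0 * z ^ 2) := by
          rw [mul_assoc, ← Real.exp_add]
          ring_nf
    · intro t ht
      refine (h 0 t (by simp)).trans ?_
      have := mul_le_mul_of_nonneg_left (abs_le.2 ht) hb
      gcongr
      linarith
  simpa using hdiff.add (.const (ψ' 0))

theorem gaussianBound_mul_scaledKernel (hm : 0 < m) (R y : ℝ) :
    GaussianBound R (m ^ 2) fun x z => ψ z * scaledKernel m α x y z :=
  (hψ.gaussianBound R).mul (gaussianBound_scaledKernel hm R y)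

theorem integrable_mul_scaledKernel (hm : 0 < m) (x y : ℝ) :
    Integrable fun z => ψ z * scaledKernel m α x y z :=
  (hψ.gaussianBound_mul_scaledKernel hm |x| y).integrable (by positivity) le_rfl
    (hψ.continuous.mul (continuous_scaledKernel x y))

theorem integrable_mul_schrodingerKernel (hm : 0 < m) (x y : ℝ) :
    Integrable fun z => ψ z * schrodingerKernel m α x y z :=
  ((hψ.gaussianBound |x|).mul (gaussianBound_schrodingerKernel hm |x| y)).integrable
    (by positivity) le_rfl (hψ.continuous.mul (continuous_schrodingerKernel x y))

/-- Green's identity in the variable `z`: the boundary terms vanish because the kernel decays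
faster than `ψ` and `ψ'` can grow. -/
theorem integral_mul_schrodingerKernel (hm : 0 < m) (x y : ℝ) :
    ∫ z, ψ z * schrodingerKernel m α x y z = -E * ∫ z, ψ z * scaledKernel m α x y z := by
  have hd : ∀ z, HasDerivAt
      (fun z => ψ z * scaledKernelDeriv m α z y x - ψ' z * scaledKernel m α x y z)
      (ψ z * schrodingerKernel m α x y z + E * (ψ z * scaledKernel m α x y z)) z := fun z => by
    have hK := hasDerivAt_scaledKernel (m := m) (α := α) z y x
    simp only [← scaledKernel_swap x y] at hK
    refine (((hψ.hasDerivAt z).mul (hasDerivAt_scaledKernelDeriv z y x)).sub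
      ((hψ.hasDerivAt_deriv z).mul hK)).congr_deriv ?_
    rw [schrodingerKernel_swap x y z, scaledKernel_swap z y x]
    ring
  have hint := (hψ.integrable_mul_schrodingerKernel hm x y).add
    ((hψ.integrable_mul_scaledKernel hm x y).const_mul E)
  have hlim : Tendsto (fun z => ψ z * scaledKernelDeriv m α z y x - ψ' z * scaledKernel m α x y z)
      (cocompact ℝ) (𝓝 0) := by
    have h1 := ((hψ.gaussianBound |x|).mul (gaussianBound_scaledKernelDeriv_swap (α := α)
      hm |x| y)).tendsto_zero (by positivity) le_rfl
    have h2 := ((hψ.gaussianBound_deriv |x|).mul (gaussianBound_scaledKernel (α := α)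
      hm |x| y)).tendsto_zero (by positivity) le_rfl
    simpa using h1.sub h2
  have h := integral_of_hasDerivAt_of_tendsto hd hint
    (hlim.mono_left atBot_le_cocompact) (hlim.mono_left atTop_le_cocompact)
  rw [integral_add (hψ.integrable_mul_schrodingerKernel hm x y)
    ((hψ.integrable_mul_scaledKernel hm x y).const_mul E), integral_const_mul] at h
  linarith

theorem hasDerivAt_integral (hm : 0 < m) (x y : ℝ) :
    HasDerivAt (fun x => ∫ z, ψ z * scaledKernel m α x y z)
      (∫ z, ψ z * scaledKernelDeriv m α x y z) x :=
  GaussianBound.hasDerivAt_integral (κ := m ^ 2) (by positivity)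
    (fun R => hψ.gaussianBound_mul_scaledKernel hm R y)
    (fun R => (hψ.gaussianBound R).mul (gaussianBound_scaledKernelDeriv hm R y))
    (fun x => hψ.continuous.mul (continuous_scaledKernel x y))
    (fun x => hψ.continuous.mul (continuous_scaledKernelDeriv x y))
    (fun x z => (hasDerivAt_scaledKernel x y z).const_mul (ψ z)) x

theorem hasDerivAt_integral_deriv (hm : 0 < m) (x y : ℝ) :
    HasDerivAt (fun x => ∫ z, ψ z * scaledKernelDeriv m α x y z)
      ((potential m α x - E) * ∫ z, ψ z * scaledKernel m α x y z) x := by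
  have h := GaussianBound.hasDerivAt_integral (κ := m ^ 2) (by positivity)
    (fun R => (hψ.gaussianBound R).mul (gaussianBound_scaledKernelDeriv (α := α) hm R y))
    (fun R => (hψ.gaussianBound R).mul ((gaussianBound_schrodingerKernel (α := α) hm R y).add
      ((gaussianBound_potential_fst (m := m) (α := α) R).mul (gaussianBound_scaledKernel hm R y))))
    (fun x => hψ.continuous.mul (continuous_scaledKernelDeriv x y))
    (fun x => hψ.continuous.mul ((continuous_schrodingerKernel x y).add
      ((continuous_scaledKernel x y).const_mul _)))
    (fun x z => (hasDerivAt_scaledKernelDeriv x y z).const_mul (ψ z)) x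
  refine h.congr_deriv ?_
  simp only [mul_add, mul_left_comm (ψ _) (potential m α x)]
  rw [integral_add (hψ.integrable_mul_schrodingerKernel hm x y)
    ((hψ.integrable_mul_scaledKernel hm x y).const_mul _), integral_const_mul,
    hψ.integral_mul_schrodingerKernel hm]
  ring

end IsBoundedSolution

/-! ### Asymptotics of the integral transform -/

/-- The normalising asymptotic profile in the parameters of `scaledKernel`. -/
noncomputable def profile (m α x : ℝ) : ℝ :=
  x⁻¹ * Real.exp (-(2 * m ^ 3 / 3) * x ^ 3 - m ^ 3 * α * x)

/-- After the leading terms of `(x ^ 2 + ρ) ^ (3 / 2)` have been cancelled against the profile and the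
exponential factor of the kernel, a Gaussian in `y - z` and a small correction remain. -/
theorem scaledKernel_div_profile (hm : 0 < m) {x y z B : ℝ} (hx : 0 < x) (hB : 0 < B)
    (hB2 : B ^ 2 = x ^ 2 + (y ^ 2 + z ^ 2 + α)) :
    (√x)⁻¹ * scaledKernel m α x y z / profile m α x =
      2 * m ^ 2 * √(m⁻¹ * (B / x)⁻¹) * airyAmplitude ((√(m * B))⁻¹ ^ 3) *
        Real.exp (-m ^ 3 * (x * (y - z) ^ 2) - 2 * m ^ 3 / 3 * ((B - x) ^ 2 * (B + x / 2))) := by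
  have hexp : Real.exp
        (-m ^ 3 * (x * (y - z) ^ 2) - 2 * m ^ 3 / 3 * ((B - x) ^ 2 * (B + x / 2))) =
      Real.exp (2 * m ^ 3 * x * y * z) * Real.exp (-(2 / 3 * (m * B) ^ 3)) /
        Real.exp (-(2 * m ^ 3 / 3) * x ^ 3 - m ^ 3 * α * x) := by
    rw [← Real.exp_add, ← Real.exp_sub]
    congr 1
    linear_combination (m ^ 3 * x) * hB2
  have hsqrt : √(m⁻¹ * (B / x)⁻¹) = √x * (√(m * B))⁻¹ := by
    rw [← Real.sqrt_inv, ← Real.sqrt_mul hx.le]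
    congr 1
    field_simp
  have hx2 : (√x)⁻¹ * x = √x := by
    have := Real.sqrt_pos.2 hx
    nth_rewrite 2 [← Real.sq_sqrt hx.le]
    field_simp
  have harg : m ^ 2 * (x ^ 2 + y ^ 2 + z ^ 2 + α) = (m * B) ^ 2 := by
    linear_combination (-m ^ 2) * hB2
  rw [hexp, hsqrt, ← hx2, scaledKernel, harg, airyAi_sq (mul_pos hm hB), profile]
  field_simp
  rw [Real.sq_sqrt hx.le]

section Remainder

variable {ρ : ℝ → ℝ} {r : ℝ} (hρ : Tendsto ρ atTop (𝓝 r))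
include hρ

theorem tendsto_sqrt_sq_add_div : Tendsto (fun x => √(x ^ 2 + ρ x) / x) atTop (𝓝 1) := by
  have h : Tendsto (fun x => √(1 + ρ x * (x⁻¹ ^ 2))) atTop (𝓝 1) := by
    have := ((hρ.mul (tendsto_inv_atTop_zero.pow 2)).const_add 1).sqrt
    simpa using this
  refine h.congr' ?_
  filter_upwards [eventually_gt_atTop 0] with x hx
  rw [show 1 + ρ x * x⁻¹ ^ 2 = (x ^ 2 + ρ x) / x ^ 2 by field_simp,
    Real.sqrt_div' _ (sq_nonneg x), Real.sqrt_sq hx.le]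

theorem tendsto_sqrt_sq_add_atTop : Tendsto (fun x => √(x ^ 2 + ρ x)) atTop atTop := by
  refine ((tendsto_sqrt_sq_add_div hρ).pos_mul_atTop one_pos tendsto_id).congr' ?_
  filter_upwards [eventually_gt_atTop 0] with x hx
  simp only [id]
  field_simp

theorem tendsto_remainder :
    Tendsto (fun x => (√(x ^ 2 + ρ x) - x) ^ 2 * (√(x ^ 2 + ρ x) + x / 2)) atTop (𝓝 0) := by
  have h : Tendsto (fun x => ρ x ^ 2 * x⁻¹) atTop (𝓝 0) := by
    simpa using (hρ.pow 2).mul tendsto_inv_atTop_zero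
  have hpos : ∀ᶠ x in atTop, 0 ≤ x ^ 2 + ρ x := by
    filter_upwards [(tendsto_sqrt_sq_add_atTop hρ).eventually_gt_atTop 0] with x hx
    exact (Real.sqrt_pos.1 hx).le
  refine squeeze_zero' ?_ ?_ h
  · filter_upwards [eventually_gt_atTop 0] with x hx
    positivity
  · filter_upwards [eventually_gt_atTop 0, hpos] with x hx hx2
    set B := √(x ^ 2 + ρ x) with hBdef
    have hB : 0 ≤ B := Real.sqrt_nonneg _
    have hB2 : ρ x = (B - x) * (B + x) := by
      have := Real.sq_sqrt hx2
      linear_combination -this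
    rw [← div_eq_mul_inv, le_div_iff₀ hx, hB2, mul_pow, mul_assoc]
    refine mul_le_mul_of_nonneg_left ?_ (sq_nonneg _)
    nlinarith [mul_nonneg hB hx.le]

end Remainder

namespace IsBoundedSolution

variable {E : ℝ} {ψ ψ' : ℝ → ℝ} (hψ : IsBoundedSolution m α E ψ ψ')
include hψ

/-- Laplace's method: for large `x` the kernel concentrates at `z = y` on the scale `x ^ (-1 / 2)`. -/
theorem tendsto_integral_div_profile (hm : 0 < m) (y : ℝ) :
    Tendsto (fun x => (∫ z, ψ z * scaledKernel m α x y z) / profile m α x) atTop (𝓝 (ψ y)) := by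
  have hpi := Real.pi_pos
  obtain ⟨M, hM⟩ := hψ.bounded
  obtain ⟨C, hC⟩ := exists_abs_airyAmplitude_le
  have hM0 : 0 ≤ M := (abs_nonneg _).trans (hM 0)
  have hC0 : 0 ≤ C := (abs_nonneg _).trans (hC 0 le_rfl)
  -- The substitution `z = y + w / √x`.
  have hsubst : ∀ᶠ x in atTop, (∫ w : ℝ, ψ (y + (√x)⁻¹ * w) *
        ((√x)⁻¹ * scaledKernel m α x y (y + (√x)⁻¹ * w) / profile m α x)) =
      (∫ z, ψ z * scaledKernel m α x y z) / profile m α x := by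
    filter_upwards [eventually_gt_atTop 0] with x hx
    have hs := Real.sqrt_pos.2 hx
    have h1 := Measure.integral_comp_mul_left
      (fun z => ψ (y + z) * scaledKernel m α x y (y + z)) (√x)⁻¹
    rw [integral_add_left_eq_self (fun z => ψ z * scaledKernel m α x y z) y, inv_inv,
      abs_of_pos hs, smul_eq_mul] at h1
    calc (∫ w : ℝ, ψ (y + (√x)⁻¹ * w) *
          ((√x)⁻¹ * scaledKernel m α x y (y + (√x)⁻¹ * w) / profile m α x))
        = (√x)⁻¹ / profile m α x *
          ∫ w : ℝ, ψ (y + (√x)⁻¹ * w) * scaledKernel m α x y (y + (√x)⁻¹ * w) := by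
          rw [← integral_const_mul]
          congr 1
          funext w
          ring
      _ = _ := by
          rw [h1]
          field_simp
  have hsq : ∀ x w : ℝ, 0 < x → x * (y - (y + (√x)⁻¹ * w)) ^ 2 = w ^ 2 := fun x w hx => by
    have hs := Real.sqrt_pos.2 hx
    rw [sub_add_cancel_left, neg_sq, mul_pow, inv_pow, Real.sq_sqrt hx.le,
      mul_inv_cancel_left₀ hx.ne']
  have hlim : ψ y = ∫ w : ℝ, ψ y * (2 * m ^ 2 * √(m⁻¹) * (1 / (2 * √Real.pi)) *
      Real.exp (-m ^ 3 * w ^ 2)) := by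
    rw [integral_const_mul, integral_const_mul, integral_gaussian,
      show √(Real.pi / m ^ 3) = √Real.pi * (√m⁻¹ * m⁻¹) by
        rw [Real.sqrt_eq_iff_mul_self_eq (by positivity) (by positivity),
          show √Real.pi * (√m⁻¹ * m⁻¹) * (√Real.pi * (√m⁻¹ * m⁻¹)) =
            √Real.pi ^ 2 * √m⁻¹ ^ 2 * m⁻¹ ^ 2 by ring, Real.sq_sqrt hpi.le,
          Real.sq_sqrt (by positivity)]
        field_simp,
      show 2 * m ^ 2 * √m⁻¹ * (1 / (2 * √Real.pi)) * (√Real.pi * (√m⁻¹ * m⁻¹)) =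
        √m⁻¹ ^ 2 * m * (√Real.pi / √Real.pi) by field_simp, Real.sq_sqrt (by positivity),
      inv_mul_cancel₀ hm.ne', div_self (Real.sqrt_pos.2 hpi).ne']
    ring
  rw [hlim]
  refine Tendsto.congr' hsubst ?_
  refine tendsto_integral_filter_of_dominated_convergence
    (fun w => M * (2 * m ^ 2 * √(m⁻¹ * 2) * C * Real.exp (-m ^ 3 * w ^ 2))) ?_ ?_
    (((integrable_exp_neg_mul_sq (by positivity)).const_mul _).const_mul _) ?_
  · refine Eventually.of_forall fun x => Continuous.aestronglyMeasurable ?_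
    have hc := hψ.continuous
    have hK := continuous_scaledKernel (m := m) (α := α) x y
    fun_prop
  · filter_upwards [eventually_gt_atTop 0, eventually_ge_atTop (2 * |α|), eventually_ge_atTop 1]
      with x hx hxα hx1
    refine Eventually.of_forall fun w => ?_
    set z := y + (√x)⁻¹ * w with hz
    have hxx : x ^ 2 / 4 ≤ x ^ 2 + (y ^ 2 + z ^ 2 + α) := by
      nlinarith [neg_abs_le α, sq_nonneg y, sq_nonneg z]
    have hpos : 0 < x ^ 2 + (y ^ 2 + z ^ 2 + α) := by nlinarith
    have hB := Real.sqrt_pos.2 hpos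
    have hBx : x / 2 ≤ √(x ^ 2 + (y ^ 2 + z ^ 2 + α)) :=
      Real.le_sqrt_of_sq_le (by linarith)
    rw [scaledKernel_div_profile hm hx hB (Real.sq_sqrt hpos.le), hz, hsq x w hx, ← hz]
    set B := √(x ^ 2 + (y ^ 2 + z ^ 2 + α))
    have h1 : √(m⁻¹ * (B / x)⁻¹) ≤ √(m⁻¹ * 2) := by
      refine Real.sqrt_le_sqrt (mul_le_mul_of_nonneg_left ?_ (by positivity))
      rw [inv_div, div_le_iff₀ hB]
      linarith
    have h2 : 0 ≤ 2 * m ^ 3 / 3 * ((B - x) ^ 2 * (B + x / 2)) := by positivity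
    rw [norm_mul, Real.norm_eq_abs, Real.norm_eq_abs, abs_mul, abs_mul, Real.abs_exp,
      abs_of_nonneg (by positivity : 0 ≤ 2 * m ^ 2 * √(m⁻¹ * (B / x)⁻¹))]
    gcongr
    · exact hM _
    · exact hC _ (by positivity)
    · linarith
  · refine Eventually.of_forall fun w => ?_
    have hZ : Tendsto (fun x : ℝ => y + (√x)⁻¹ * w) atTop (𝓝 y) := by
      simpa using ((tendsto_inv_atTop_zero.comp Real.tendsto_sqrt_atTop).mul_const w).const_add y
    have hρ : Tendsto (fun x : ℝ => y ^ 2 + (y + (√x)⁻¹ * w) ^ 2 + α) atTop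
        (𝓝 (y ^ 2 + y ^ 2 + α)) := ((hZ.pow 2).const_add _).add_const _
    have hB := tendsto_sqrt_sq_add_atTop hρ
    have hamp := tendsto_airyAmplitude.comp
      (tendsto_inv_sqrt_pow.comp (hB.const_mul_atTop hm))
    have hroot := ((((tendsto_sqrt_sq_add_div hρ).inv₀ one_ne_zero).const_mul
      m⁻¹).sqrt).const_mul (2 * m ^ 2)
    have hexp := (Real.continuous_exp.tendsto _).comp
      (((tendsto_remainder hρ).const_mul (2 * m ^ 3 / 3)).const_sub (-m ^ 3 * w ^ 2))
    have hall := ((hψ.continuous.tendsto y).comp hZ).mul ((hroot.mul hamp).mul hexp)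
    simp only [inv_one, mul_one, mul_zero, sub_zero] at hall
    refine hall.congr' ?_
    filter_upwards [eventually_gt_atTop 0, hB.eventually_gt_atTop 0] with x hx hBx
    rw [scaledKernel_div_profile hm hx hBx (Real.sq_sqrt (Real.sqrt_pos.1 hBx).le), hsq x w hx]
    rfl

end IsBoundedSolution

/-! ### Uniqueness of the decaying solution -/

/-- A solution of `u'' = Q u` that vanishes at `x₀` and at `+∞`, where `Q ≥ 0` on `[x₀, ∞)`, is zero:
`u ^ 2` is increasing on `[x₀, ∞)`, and to the left of `x₀` the energy `u ^ 2 + u' ^ 2` is controlled by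
Grönwall's inequality. -/
theorem eq_zero_of_tendsto_zero {u u' Q : ℝ → ℝ} {x₀ : ℝ} (hQ : Continuous Q)
    (hu : ∀ x, HasDerivAt u (u' x) x) (hu' : ∀ x, HasDerivAt u' (Q x * u x) x)
    (hQ0 : ∀ x, x₀ ≤ x → 0 ≤ Q x) (h0 : u x₀ = 0) (hlim : Tendsto u atTop (𝓝 0)) (x : ℝ) :
    u x = 0 := by
  have hd1 : ∀ x, HasDerivAt (fun x => u x * u' x) (u' x ^ 2 + Q x * u x ^ 2) x := fun x =>
    ((hu x).mul (hu' x)).congr_deriv (by ring)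
  have hd2 : ∀ x, HasDerivAt (fun x => u x ^ 2) (2 * (u x * u' x)) x := fun x =>
    ((hu x).pow 2).congr_deriv (by simp; ring)
  have hmono1 : MonotoneOn (fun x => u x * u' x) (Set.Ici x₀) := by
    refine monotoneOn_of_deriv_nonneg (convex_Ici _)
      (fun x _ => (hd1 x).continuousAt.continuousWithinAt)
      (fun x _ => (hd1 x).differentiableAt.differentiableWithinAt) fun x hx => ?_
    rw [interior_Ici] at hx
    have := hQ0 x (le_of_lt hx)
    rw [(hd1 x).deriv]
    positivity
  have hmono2 : MonotoneOn (fun x => u x ^ 2) (Set.Ici x₀) := by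
    refine monotoneOn_of_deriv_nonneg (convex_Ici _)
      (fun x _ => (hd2 x).continuousAt.continuousWithinAt)
      (fun x _ => (hd2 x).differentiableAt.differentiableWithinAt) fun x hx => ?_
    rw [interior_Ici] at hx
    have h := hmono1 Set.self_mem_Ici (Set.mem_Ici.2 (le_of_lt hx)) (le_of_lt hx)
    simp only [h0, zero_mul] at h
    rw [(hd2 x).deriv]
    positivity
  have hright : ∀ x, x₀ ≤ x → u x = 0 := fun x hx => by
    have h : u x ^ 2 ≤ 0 := by
      refine ge_of_tendsto (by simpa using hlim.pow 2) ?_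
      filter_upwards [eventually_ge_atTop x] with t ht
      exact hmono2 (Set.mem_Ici.2 hx) (Set.mem_Ici.2 (hx.trans ht)) ht
    exact pow_eq_zero_iff two_ne_zero |>.1 (le_antisymm h (sq_nonneg _))
  rcases le_total x₀ x with hx | hx
  · exact hright x hx
  -- The derivative vanishes at `x₀ + 1`, since `u` is zero in a neighbourhood of that point.
  have hder : u' (x₀ + 1) = 0 := by
    refine (hu (x₀ + 1)).unique ((hasDerivAt_const (x₀ + 1) (0 : ℝ)).congr_of_eventuallyEq ?_)
    filter_upwards [lt_mem_nhds (lt_add_one x₀)] with t ht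
    exact hright t (le_of_lt ht)
  obtain ⟨M, hM⟩ := (isCompact_Icc (a := x) (b := x₀ + 1)).exists_bound_of_continuousOn
    hQ.continuousOn
  have hd3 : ∀ t, HasDerivAt (fun t => (u t ^ 2 + u' t ^ 2) * Real.exp ((1 + M) * t))
      ((2 * (1 + Q t) * (u t * u' t) + (1 + M) * (u t ^ 2 + u' t ^ 2)) *
        Real.exp ((1 + M) * t)) t := fun t => by
    have he := ((hasDerivAt_id t).const_mul (1 + M)).exp
    refine (((hd2 t).add ((hu' t).pow 2)).mul he).congr_deriv ?_
    simp
    ring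
  have hmono3 : MonotoneOn (fun t => (u t ^ 2 + u' t ^ 2) * Real.exp ((1 + M) * t))
      (Set.Icc x (x₀ + 1)) := by
    refine monotoneOn_of_deriv_nonneg (convex_Icc _ _)
      (fun x _ => (hd3 x).continuousAt.continuousWithinAt)
      (fun x _ => (hd3 x).differentiableAt.differentiableWithinAt) fun t ht => ?_
    rw [interior_Icc] at ht
    rw [(hd3 t).deriv]
    refine mul_nonneg ?_ (Real.exp_pos _).le
    have hQt := abs_le.1 (hM t ⟨ht.1.le, ht.2.le⟩)
    have h1 : -(u t ^ 2 + u' t ^ 2) ≤ 2 * (u t * u' t) := by nlinarith [sq_nonneg (u t + u' t)]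
    have h2 : 2 * (u t * u' t) ≤ u t ^ 2 + u' t ^ 2 := by nlinarith [sq_nonneg (u t - u' t)]
    nlinarith [hQt.1, hQt.2]
  have h := hmono3 (Set.left_mem_Icc.2 (by linarith)) (Set.right_mem_Icc.2 (by linarith))
    (by linarith)
  simp only [hright (x₀ + 1) (by linarith), hder] at h
  have h5 : u x ^ 2 + u' x ^ 2 ≤ 0 := by
    by_contra! hc
    have := mul_pos hc (Real.exp_pos ((1 + M) * x))
    simp at h
    linarith
  have := sq_nonneg (u' x)
  exact pow_eq_zero_iff two_ne_zero |>.1 (le_antisymm (by linarith) (sq_nonneg _))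

theorem tendsto_potential (hm : 0 < m) : Tendsto (potential m α) atTop atTop := by
  have h2 : Tendsto (fun x : ℝ => x ^ 2) atTop atTop := tendsto_pow_atTop two_ne_zero
  have h := (h2.atTop_mul_atTop₀ (tendsto_atTop_add_const_left _ α h2)).const_mul_atTop
    (by positivity : 0 < 4 * m ^ 6)
  refine h.congr fun x => ?_
  rw [potential]
  ring

/-! ### The product formula -/

/-- The integral transform of `ψ` is a decaying solution, hence a multiple of `ψ`; the asymptotics
identify the factor. -/
theorem IsBoundedSolution.mul_eq_integral {E : ℝ} {ψ ψ' : ℝ → ℝ}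
    (hψ : IsBoundedSolution m α E ψ ψ') (hm : 0 < m) (hlim : Tendsto ψ atTop (𝓝 0))
    (hnorm : Tendsto (fun x => ψ x / profile m α x) atTop (𝓝 1)) (x y : ℝ) :
    ψ x * ψ y = ∫ z, ψ z * scaledKernel m α x y z := by
  set F := fun x => ∫ z, ψ z * scaledKernel m α x y z with hF
  have hFlim := hψ.tendsto_integral_div_profile hm y
  have hne : ∀ᶠ x in atTop, ψ x / profile m α x ≠ 0 := hnorm.eventually_ne one_ne_zero
  have hratio : Tendsto (fun x => F x / ψ x) atTop (𝓝 (ψ y)) := by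
    have h := hFlim.div hnorm one_ne_zero
    rw [div_one] at h
    refine h.congr' ?_
    filter_upwards [hne] with x hx
    exact div_div_div_cancel_right₀ (div_ne_zero_iff.1 hx).2 _ _
  have hFzero : Tendsto F atTop (𝓝 0) := by
    have h := hratio.mul hlim
    rw [mul_zero] at h
    refine h.congr' ?_
    filter_upwards [hne] with x hx
    exact div_mul_cancel₀ _ (div_ne_zero_iff.1 hx).1
  obtain ⟨X, hX⟩ := eventually_atTop.1
    (((tendsto_potential (α := α) hm).eventually_ge_atTop E).and hne)
  have hprop : ∀ x, F x = F X / ψ X * ψ x := fun x => by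
    refine sub_eq_zero.1 (eq_zero_of_tendsto_zero (u := fun x => F x - F X / ψ X * ψ x)
      (u' := fun x => (∫ z, ψ z * scaledKernelDeriv m α x y z) - F X / ψ X * ψ' x)
      (Q := fun x => potential m α x - E) (x₀ := X) ?_ ?_ ?_ ?_ ?_ ?_ x)
    · unfold potential
      fun_prop
    · exact fun x => (hψ.hasDerivAt_integral hm x y).sub ((hψ.hasDerivAt x).const_mul _)
    · exact fun x => ((hψ.hasDerivAt_integral_deriv hm x y).sub
        ((hψ.hasDerivAt_deriv x).const_mul _)).congr_deriv (by simp only [hF]; ring)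
    · exact fun x hx => sub_nonneg.2 (hX x hx).1
    · simp [div_mul_cancel₀ _ (div_ne_zero_iff.1 (hX X le_rfl).2).1]
    · simpa using hFzero.sub (hlim.const_mul _)
  have hconst : F X / ψ X = ψ y := by
    refine tendsto_nhds_unique (tendsto_const_nhds.congr' ?_) hratio
    filter_upwards [hne] with x hx
    rw [hprop x, mul_div_cancel_right₀ _ (div_ne_zero_iff.1 hx).1]
  change ψ x * ψ y = F x
  rw [hprop x, hconst, mul_comm]

theorem IsEigenfunction.bounded {a lam E : ℝ} {ψ : ℝ → ℝ} (h : IsEigenfunction a lam E ψ) :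
    ∃ M, ∀ x, |ψ x| ≤ M := by
  have h0 : Tendsto ψ (cocompact ℝ) (𝓝 0) := by
    rw [cocompact_eq_atBot_atTop]
    exact h.tendsto_atBot.sup h.tendsto_atTop
  obtain ⟨C, hC⟩ := ZeroAtInftyContinuousMap.bounded
    (⟨⟨ψ, h.differentiable.continuous⟩, h0⟩ : ZeroAtInftyContinuousMap ℝ ℝ)
  refine ⟨C + |ψ 0|, fun x => ?_⟩
  have h1 : |ψ x - ψ 0| ≤ C := hC x 0
  linarith [abs_sub_abs_le_abs_sub (ψ x) (ψ 0)]

/-- The scaling of the parameters. -/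
theorem exists_scale (a : ℝ) {lam : ℝ} (hlam : 0 < lam) :
    ∃ m α : ℝ, 0 < m ∧ a = 4 * m ^ 6 * α ∧ lam = 8 * m ^ 6 ∧ lam ^ (1 / 3 : ℝ) = 2 * m ^ 2 ∧
      lam ^ (2 / 3 : ℝ) = 4 * m ^ 4 ∧ √(lam / 2) = 2 * m ^ 3 := by
  obtain ⟨m, hm, hm6⟩ : ∃ m : ℝ, 0 < m ∧ m ^ 6 = lam / 8 := by
    refine ⟨(lam / 8) ^ ((6 : ℕ) : ℝ)⁻¹, by positivity, ?_⟩
    exact Real.rpow_inv_natCast_pow (by positivity) (by norm_num)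
  have h3 : lam = (2 * m ^ 2) ^ 3 := by linear_combination (-8) * hm6
  have h13 : lam ^ (1 / 3 : ℝ) = 2 * m ^ 2 := by
    rw [h3, show (1 / 3 : ℝ) = ((3 : ℕ) : ℝ)⁻¹ by norm_num]
    exact Real.pow_rpow_inv_natCast (by positivity) (by norm_num)
  refine ⟨m, a / (4 * m ^ 6), hm, by field_simp, by linarith, h13, ?_, ?_⟩
  · rw [show (2 / 3 : ℝ) = 1 / 3 * (2 : ℕ) by norm_num, Real.rpow_mul hlam.le, h13,
      Real.rpow_natCast]
    ring
  · rw [show lam / 2 = (2 * m ^ 3) ^ 2 by linear_combination (-4) * hm6]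
    exact Real.sqrt_sq (by positivity)

end QuarticOscillator

open QuarticOscillator in
theorem theorem1 (a lam : ℝ) (hlam : 0 < lam) :
    (∀ (E : ℝ) (ψ : ℝ → ℝ),
      QuarticOscillator.IsEigenfunction a lam E ψ →
      QuarticOscillator.IsNormalized a lam ψ →
      ∀ x y : ℝ,
        Integrable (fun z : ℝ => ψ z * QuarticOscillator.kernelK a lam x y z) volume ∧
        ψ x * ψ y = ∫ z : ℝ, ψ z * QuarticOscillator.kernelK a lam x y z) ∧
    IsGreatest {s : ℝ | QuarticOscillator.airyAi s = 0} QuarticOscillator.airyFirstZero ∧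
    (lam ^ (2 / 3 : ℝ) * QuarticOscillator.airyFirstZero < a →
      ∀ x y z : ℝ, 0 < QuarticOscillator.kernelK a lam x y z) := by
  obtain ⟨m, α, hm, ha, hlam6, h13, h23, hsqrt⟩ := exists_scale a hlam
  have hker : ∀ x y z, kernelK a lam x y z = scaledKernel m α x y z := fun x y z => by
    rw [kernelK, scaledKernel, h13, h23, hsqrt, ha]
    congr 2
    field_simp
  refine ⟨fun E ψ hE hN x y => ?_, isGreatest_airyFirstZero, fun h x y z => ?_⟩
  · have hψ : IsBoundedSolution m α E ψ (deriv ψ) := by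
      refine ⟨fun x => (hE.differentiable x).hasDerivAt, fun x => ?_, hE.bounded⟩
      refine (hE.differentiable_deriv x).hasDerivAt.congr_deriv ?_
      have := hE.ode x
      rw [ha, hlam6] at this
      rw [potential]
      linear_combination -this
    have hprofile : Tendsto (fun x => ψ x / profile m α x) atTop (𝓝 1) := by
      have hN' : Asymptotics.IsEquivalent atTop ψ (profile m α) := by
        unfold IsNormalized at hN
        convert hN using 2 with x
        rw [profile, hsqrt, ha]
        congr 2
        field_simp
        ring
      refine (Asymptotics.isEquivalent_iff_tendsto_one ?_).1 hN'
      filter_upwards [eventually_gt_atTop 0] with x hx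
      unfold profile
      positivity
    simp only [hker]
    exact ⟨hψ.integrable_mul_scaledKernel hm x y,
      hψ.mul_eq_integral hm hE.tendsto_atTop hprofile x y⟩
  · rw [hker, scaledKernel]
    have h1 : airyFirstZero < m ^ 2 * (x ^ 2 + y ^ 2 + z ^ 2 + α) := by
      rw [h23, ha, show 4 * m ^ 6 * α = 4 * m ^ 4 * (m ^ 2 * α) by ring] at h
      have h2 := lt_of_mul_lt_mul_left h (by positivity)
      have h3 : 0 ≤ m ^ 2 * (x ^ 2 + y ^ 2 + z ^ 2) := by positivity
      linarith
    have := airyAi_pos_of_airyFirstZero_lt h1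
    positivity
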